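/- **Conventions.** Write $\{x\}=x-x^{-1}$, $D=\{A\}/\{q\}$, $\phi=A\{q\}$ and, for $m\in\mathbb Z$, $\Phi_m=\frac{(1+\phi D)^m-1}{D}=\frac{A^{2m}-1}{D}$. Let $H^{L}(A,q)$ be the HOMFLY polynomial of an oriented link $L$ in the topological framing, normalised by $A\,H^{L_+}-A^{-1}H^{L_-}=\{q\}H^{L_0}$ and $H^{\rm unknot}=D$; for every $N\ge 1$ its value at $A=q^N$ is $A^{-w}$ times the $R$-matrix state sum of the fundamental representation of $U_q(\mathfrak{sl}_N)$ on a diagram of $L$ with writhe $w$. **The knots.** Let $n\ge1$ and $p_1,\dots,p_n\in\mathbb Z$. Take a planar disc with $n$ thin bands attached side by side to its boundary, each band being a finger with a free tip. The knot $K(p_1,\dots,p_n)$ is the boundary of the resulting (singular) disc, where band $i$ first runs through a box with $p_i$ half-twists (the two edges of the band are anti-parallel; the $|p_i|$ crossings are positive if $p_i>0$ and negative if $p_i<0$); then band $i$ passes transversally between the two edges of the end of band $i+1$, one of these edges lying over band $i$ and the other one under it; and finally the end of band $i$ hooks band $i-1$ in the same manner. Indices are taken modulo $n$, and the end of band $1$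 is led around all other bands to hook band $n$. At each of the $n$ hooks it is fixed once and for all which of the two edges of the hooking band lies over; the result holds for every such choice. **Statement.** Let $p_i=2m_i+\varepsilon_i$ with $m_i\in\mathbb Z$ and $\varepsilon_i\in\{0,1\}$, and let $$P^{K(2m_1+\varepsilon_1,\dots,2m_n+\varepsilon_n)}:=A^{2(m_1+\dots+m_n)}\,H^{K(2m_1+\varepsilon_1,\dots,2m_n+\varepsilon_n)}$$ be the polynomial in the vertical framing on the $m_i$ anti-parallel locks in the boxes and in the topological framing elsewhere (so that $P^{K(\varepsilon_1,\dots,\varepsilon_n)}=H^{K(\varepsilon_1,\dots,\varepsilon_n)}$). Then $$P^{K(2m_1+\varepsilon_1,\dots,2m_n+\varepsilon_n)}=P^{K(\varepsilon_1,\dots,\varepsilon_n)}+\Phi_{m_1+\dots+m_n}D^2 .$$ This holds at $A=q^N$ for every $N\ge1$, and as an identity of Laurent polynomials in $A$ over $\mathbb Q(q)$: if $P\in\mathbb Q(q)[A^{\pm1}]$ specialises at $A=q^N$ to the invariant of $K(\varepsilon_1,\dots,\varepsilon_n)$ for all $N\ge1$, then $A^{-2\sum m_i}\big(P+\Phi_{\sum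 m_i}D^2\big)$ specialises in the same way to the invariant of $K(2m_1+\varepsilon_1,\dots,2m_n+\varepsilon_n)$. Consequently, for fixed parities of the $p_i$, the HOMFLY polynomial of $K(p_1,\dots,p_n)$ depends only on the sum $p_1+\dots+p_n$ and not on the parameters separately. -/

import Mathlib

/-! ### Oriented link diagrams, sliced by height

A diagram is read from bottom to top as a list of elementary slices.  At each height the strands are
numbered `0, 1, 2, …` from left to right, and the orientation of a strand is `true` if it is
directed upwards and `false` if it is directed downwards. -/

/-- An elementary slice, all other strands being vertical.
* `cup x b`: a local minimum, creating strands `x` and `x + 1` with orientations `b` and `!b`;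
* `cap x`: a local maximum, joining strands `x` and `x + 1`;
* `cross x o`: a crossing of strands `x` and `x + 1`; the strand running from bottom left to top
  right is the over-strand if and only if `o = true`. -/
inductive Slice : Type
  | cup (x : ℕ) (b : Bool)
  | cap (x : ℕ)
  | cross (x : ℕ) (o : Bool)

/-- The sign of a crossing whose bottom left and bottom right strands have orientations `a`, `b`;
`true` means positive. -/
def positiveCrossing (o a b : Bool) : Bool := o == (a == b)

/-- The sum of the signs of the crossings of a diagram, starting from strands with the
given orientations. -/
def writheFrom : List Slice → List Bool → ℤ
  | [], _ => 0
  | .cup x b :: d, σ => writheFrom d (σ.take x ++ b :: (!b) :: σ.drop x)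
  | .cap x :: d, σ => writheFrom d (σ.take x ++ σ.drop (x + 2))
  | .cross x o :: d, σ =>
      match σ.drop x with
      | a :: b :: r =>
          (if positiveCrossing o a b then 1 else -1) + writheFrom d (σ.take x ++ b :: a :: r)
      | _ => 0

/-- The writhe of a closed diagram. -/
def writhe (d : List Slice) : ℤ := writheFrom d []

/-! ### The `R`-matrix state sum of the fundamental representation of `U_q(sl_N)` -/

section StateSum

variable {F : Type*} [Field F]

/-- Matrix entries of the `R`-matrix (`s = true`) and of its inverse (`s = false`), for a crossing of
two upward strands with colours `i j` at the bottom and `k l` at the top.  The eigenvalues of `R` are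
`q` and `-q⁻¹`, that is `R - R⁻¹ = q - q⁻¹`. -/
def rMatrix (q : F) {N : ℕ} (s : Bool) (i j k l : Fin N) : F :=
  if i = j then
    if k = i ∧ l = i then (if s then q else q⁻¹) else 0
  else if k = j ∧ l = i then 1
  else if k = i ∧ l = j then
    (if s then (if j < i then q - q⁻¹ else 0) else (if i < j then -(q - q⁻¹) else 0))
  else 0

/-- The weight `q ^ (N - 1 - 2 i)` of the colour `i`; the sum of these weights is
the quantum dimension. -/
def colourWeight (q : F) {N : ℕ} (i : Fin N) : F := q ^ ((N : ℤ) - 1 - 2 * (i : ℤ))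

/-- A cup directed downwards on its left branch carries the inverse of the colour weight. -/
def cupWeight (q : F) {N : ℕ} (b : Bool) (i : Fin N) : F := if b then 1 else (colourWeight q i)⁻¹

/-- A cap directed upwards on its left branch carries the colour weight. -/
def capWeight (q : F) {N : ℕ} (b : Bool) (i : Fin N) : F := if b then colourWeight q i else 1

/-- Matrix entries of a crossing of strands with orientations `a b` and colours `i j` at the bottom,
and colours `k l` at the top.  A crossing that involves downward strands is the upward crossing of
the same sign, rotated by means of cups and caps. -/
def crossWeight (q : F) {N : ℕ} (o a b : Bool) (i j k l : Fin N) : F :=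
  match a, b with
  | true, true => rMatrix q (positiveCrossing o a b) i j k l
  | false, false => rMatrix q (positiveCrossing o a b) l k j i
  | true, false =>
      cupWeight q false k * capWeight q true j * rMatrix q (positiveCrossing o a b) k i l j
  | false, true =>
      cupWeight q true l * capWeight q false i * rMatrix q (positiveCrossing o a b) j l i k

/-- The state sum of the part of a diagram above a level at which the strands have the given
orientations and colours: the sum, over all colourings of the arcs above that level by `Fin N`, of
the products of the weights of the slices.  It is `0` for a list that is not a diagram. -/
def stateSumFrom (q : F) (N : ℕ) : List Slice → List (Bool × Fin N) → F
  | [], σ => if σ = [] then 1 else 0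
  | .cup x b :: d, σ =>
      if x ≤ σ.length then
        ∑ i : Fin N,
          cupWeight q b i * stateSumFrom q N d (σ.take x ++ (b, i) :: (!b, i) :: σ.drop x)
      else 0
  | .cap x :: d, σ =>
      match σ.drop x with
      | (a, i) :: (b, j) :: r =>
          if a ≠ b ∧ i = j then capWeight q a i * stateSumFrom q N d (σ.take x ++ r) else 0
      | _ => 0
  | .cross x o :: d, σ =>
      match σ.drop x with
      | (a, i) :: (b, j) :: r =>
          ∑ k : Fin N, ∑ l : Fin N,
            crossWeight q o a b i j k l * stateSumFrom q N d (σ.take x ++ (b, k) :: (a, l) :: r)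
      | _ => 0

/-- The HOMFLY polynomial of a closed diagram at `A = q ^ N`, in the topological framing: the state
sum (which is in the vertical framing) corrected by the framing factor `A ^ (-writhe)`.  It satisfies
`A H₊ - A⁻¹ H₋ = (q - q⁻¹) H₀`, and the unknot has the value `D = (A - A⁻¹) / (q - q⁻¹)`. -/
def homflyAt (q : F) (N : ℕ) (d : List Slice) : F :=
  (q ^ N) ^ (-writhe d) * stateSumFrom q N d []

/-- `D = {A} / {q}` at `A = q ^ N`. -/
def dimAt (q : F) (N : ℕ) : F := (q ^ N - (q ^ N)⁻¹) / (q - q⁻¹)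

end StateSum

/-! ### The coefficients of the chains of anti-parallel locks -/

/-- `Φ_m = ((1 + φ D) ^ m - 1) / D` for `m ≥ 0`, and `Φ_{-m} = ((1 + φ' D) ^ m - 1) / D`, with the
division by `D` carried out, so that the formula makes sense in every commutative ring. -/
def chainCoeff {R : Type*} [CommRing R] (φ φ' D : R) : ℤ → R
  | .ofNat m => φ * ∑ k ∈ Finset.range m, (1 + φ * D) ^ k
  | .negSucc m => φ' * ∑ k ∈ Finset.range (m + 1), (1 + φ' * D) ^ k

theorem chainCoeff_natCast_mul {R : Type*} [CommRing R] (φ φ' D : R) (m : ℕ) :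
    chainCoeff φ φ' D (m : ℤ) * D = (1 + φ * D) ^ m - 1 := by
  have h := mul_geom_sum (1 + φ * D) m
  change φ * (∑ k ∈ Finset.range m, (1 + φ * D) ^ k) * D = _
  rw [← h]; ring

theorem chainCoeff_neg_mul {R : Type*} [CommRing R] (φ φ' D : R) (m : ℕ) :
    chainCoeff φ φ' D (-(m : ℤ)) * D = (1 + φ' * D) ^ m - 1 := by
  cases m with
  | zero => simpa using chainCoeff_natCast_mul φ φ' D 0
  | succ m =>
    have h := mul_geom_sum (1 + φ' * D) (m + 1)
    change φ' * (∑ k ∈ Finset.range (m + 1), (1 + φ' * D) ^ k) * D = _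
    rw [← h]; ring

/-- `Φ_m` at `A = q ^ N`, with `φ = A {q}` and `φ' = -A⁻¹ {q}`. -/
def chainCoeffAt {F : Type*} [Field F] (q : F) (N : ℕ) (m : ℤ) : F :=
  chainCoeff (q ^ N * (q - q⁻¹)) (-((q ^ N)⁻¹ * (q - q⁻¹))) (dimAt q N) m

/-! ### The HOMFLY polynomial in two variables

Laurent polynomials in `A` with coefficients in `ℚ(q)`. -/

noncomputable section TwoVariables

/-- The variable `q` of `ℚ(q)`. -/
def qVar : RatFunc ℚ := RatFunc.X

/-- The power `A ^ k` of the variable `A`. -/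
def powA (k : ℤ) : LaurentPolynomial (RatFunc ℚ) := LaurentPolynomial.T k

/-- `{q} = q - q⁻¹` as an element of the ring of Laurent polynomials in `A`. -/
def braceQ : LaurentPolynomial (RatFunc ℚ) := LaurentPolynomial.C (qVar - qVar⁻¹)

/-- `D = {A} / {q}` in two variables. -/
def dimTwo : LaurentPolynomial (RatFunc ℚ) :=
  (powA 1 - powA (-1)) * LaurentPolynomial.C (qVar - qVar⁻¹)⁻¹

/-- `Φ_m` in two variables. -/
def chainCoeffTwo (m : ℤ) : LaurentPolynomial (RatFunc ℚ) :=
  chainCoeff (powA 1 * braceQ) (-(powA (-1) * braceQ)) dimTwo m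

/-- The specialisation `A = q ^ N`. -/
def specialise (N : ℕ) : LaurentPolynomial (RatFunc ℚ) →+* RatFunc ℚ :=
  LaurentPolynomial.eval₂ (RingHom.id (RatFunc ℚ))
    (Units.mk0 (qVar ^ N) (pow_ne_zero N RatFunc.X_ne_zero))

/-- `P` is the HOMFLY polynomial `H(A, q)` of the diagram `d`: for every `N ≥ 1` its specialisation at
`A = q ^ N` is the `U_q(sl_N)` invariant.  There is at most one such `P`, since the elements `q ^ N`
are pairwise distinct. -/
def IsHomfly (d : List Slice) (P : LaurentPolynomial (RatFunc ℚ)) : Prop :=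
  ∀ N : ℕ, 1 ≤ N → specialise N P = homflyAt qVar N d

end TwoVariables

/-! ### Kanenobu's knots with several parameters

Take a circle that bounds a disc, with `n + 1` bands attached to it side by side, numbered
`0, …, n` from left to right.  Band `i` first runs through a box with `p i` half-twists; then it passes
between the two edges of the end of band `i + 1`, one edge lying over band `i` and the other one under
it (so band `i` runs through the loop at the end of band `i + 1`); and finally the end of band `i`
hooks band `i - 1` in the same way.  The indices are cyclic: the end of band `0` hooks band `n`. -/

/-- The box with `|p|` crossings of the strands `x` and `x + 1`, which are positive for `p > 0` and
negative for `p < 0` if the two strands are anti-parallel. -/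
def twistBox (x : ℕ) (p : ℤ) : List Slice :=
  List.replicate p.natAbs (.cross x (decide (p < 0)))

/-- The band `(x + 2, x + 3)` ends in a finger that hooks the band `(x, x + 1)` from the right: its
left edge passes over the band and its right edge under it if `o = true`, and the other way
round otherwise; then the two edges are joined. -/
def hookFromRight (x : ℕ) (o : Bool) : List Slice :=
  [.cross (x + 1) (!o), .cross x (!o), .cross (x + 2) o, .cross (x + 1) o, .cap x]

/-- The tip, read from bottom to top, of a finger that comes down on the right of the band
`(x, x + 1)` and hooks it; it leaves the finger as the strands `x + 2` and `x + 3`. The edge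
that becomes strand `x + 3` passes over the band and the other edge under it if `o = true`, and the
other way round otherwise. -/
def hookTip (x : ℕ) (b o : Bool) : List Slice :=
  [.cup x b, .cross (x + 1) o, .cross (x + 2) o, .cross x (!o), .cross (x + 1) (!o)]

/-- The diagram of `K(p_0, …, p_n)`.  `o i` records whether, at the hook that catches band `i`, the
left edge of the hooking band is the one that passes over.  Band `0`, after it has been caught by the
end of band `1`, bends over all the others and comes down on their right to hook band `n`; the
strands of each band are anti-parallel. -/
def kanenobu {n : ℕ} (o : Fin (n + 1) → Bool) (p : Fin (n + 1) → ℤ) : List Slice :=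
  (.cup 0 true :: (List.range n).map fun i => .cup (2 * i + 1) false)
  ++ (List.finRange (n + 1)).flatMap (fun i : Fin (n + 1) => twistBox (2 * (i : ℕ)) (p i))
  ++ hookTip (2 * n) (decide (Even (p 0))) (o (Fin.last n))
  ++ (List.finRange n).reverse.flatMap (fun i : Fin n => hookFromRight (2 * (i : ℕ)) (o i.castSucc))
  ++ [.cap 1, .cap 0]

/-! Every slice acts linearly on functions of the coloured strands above it, and a diagram acts as
the product of its slices, the lowest one leftmost. Diagram moves become identities between such
operators, and the state sum is the value at the empty list of the whole product applied to the
indicator function of the empty list.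

Write A for `q ^ N`. Adding two half-twists to box i inserts a lock, which may be moved above all
boxes (`boxes_add_two`). The skein relation and the first two Reidemeister moves give lock =
identity + A(q - q⁻¹) · (cap followed by cup) on anti-parallel strands (`lock_apply`). The second
term cuts band i above the boxes, and this unravels the cyclic chain of hooks. The upper stub of
band i releases band i + 1, which releases band i + 2, and so on, until the finger of band 0 is
free; that finger then frees the bands below i. What remains is one circle, of value D, and a cap on
every band just above its box (`cap_cup_hookTip_hookChain`). The boxes below the caps are mere
kinks, contributing A to the power ∑ p (`boxes_mul_cap_pow`), and the disc with closed bands is an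
unknot, of value D (`bandCups_cap_pow`).

Hence a lock in any box adds A(q - q⁻¹)D · A^(∑ p) · D to the state sum
(`stateSumFrom_bandDiagram_add_two`). Since A(q - q⁻¹)D = A² - 1, this is exactly the change of A^(∑
p) · D, so the difference S of the state sum and A^(∑ p) · D depends only on the parities of the p i
(`reducedStateSum_congr`). The writhe of the diagram is ∑ p because the crossings at each hook
cancel in pairs, so H = A^(-∑ p) · S + D (`homflyAt_kanenobu`). Both assertions at A = q ^ N can be
read off from this formula, together with Φ_m · D = A^(2m) - 1. The two-variable form follows
because specialisation at each N is a ring homomorphism. -/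

/-! ### Slices as linear operators -/

namespace LinkDiagram

section Operators

variable {F : Type*} [Field F]

/-- The action of a slice on functions of the coloured strands above it. -/
def sliceFun (q : F) (N : ℕ) :
    Slice → (List (Bool × Fin N) → F) → List (Bool × Fin N) → F
  | .cup x b, f, σ =>
      if x ≤ σ.length then
        ∑ i : Fin N, cupWeight q b i * f (σ.take x ++ (b, i) :: (!b, i) :: σ.drop x)
      else 0
  | .cap x, f, σ =>
      match σ.drop x with
      | (a, i) :: (b, j) :: r =>
          if a ≠ b ∧ i = j then capWeight q a i * f (σ.take x ++ r) else 0
      | _ => 0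
  | .cross x o, f, σ =>
      match σ.drop x with
      | (a, i) :: (b, j) :: r =>
          ∑ k : Fin N, ∑ l : Fin N,
            crossWeight q o a b i j k l * f (σ.take x ++ (b, k) :: (a, l) :: r)
      | _ => 0

/-- The linear operator of a slice on functions of the coloured strands. -/
def sliceOp (q : F) (N : ℕ) (s : Slice) : Module.End F (List (Bool × Fin N) → F) where
  toFun := sliceFun q N s
  map_add' f g := by
    funext σ
    cases s with
    | cup x b =>
      simp only [sliceFun, Pi.add_apply]
      split_ifs <;> simp [mul_add, Finset.sum_add_distrib]
    | cap x =>
      simp only [sliceFun, Pi.add_apply]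
      split <;> [skip; simp]
      split_ifs <;> simp [mul_add]
    | cross x o =>
      simp only [sliceFun, Pi.add_apply]
      split <;> simp [mul_add, Finset.sum_add_distrib]
  map_smul' c f := by
    funext σ
    cases s with
    | cup x b =>
      simp only [sliceFun, Pi.smul_apply, smul_eq_mul, RingHom.id_apply]
      split_ifs <;> simp [Finset.mul_sum, mul_left_comm]
    | cap x =>
      simp only [sliceFun, Pi.smul_apply, smul_eq_mul, RingHom.id_apply]
      split <;> [skip; simp]
      split_ifs <;> simp [mul_left_comm]
    | cross x o =>
      simp only [sliceFun, Pi.smul_apply, smul_eq_mul, RingHom.id_apply]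
      split <;> simp [Finset.mul_sum, mul_left_comm]

theorem sliceOp_apply (q : F) {N : ℕ} (s : Slice) (f : List (Bool × Fin N) → F)
    (σ : List (Bool × Fin N)) : sliceOp q N s f σ = sliceFun q N s f σ := rfl

/-- The linear operator of a diagram on functions of the coloured strands. -/
def diagramOp (q : F) (N : ℕ) (d : List Slice) : Module.End F (List (Bool × Fin N) → F) :=
  (d.map (sliceOp q N)).prod

variable (q : F) {N : ℕ}

@[simp] theorem diagramOp_nil : diagramOp q N [] = 1 := rfl

theorem diagramOp_cons (s : Slice) (d : List Slice) :
    diagramOp q N (s :: d) = sliceOp q N s * diagramOp q N d := by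
  simp [diagramOp]

theorem diagramOp_append (d e : List Slice) :
    diagramOp q N (d ++ e) = diagramOp q N d * diagramOp q N e := by
  simp [diagramOp]

theorem stateSumFrom_eq (d : List Slice) (σ : List (Bool × Fin N)) :
    stateSumFrom q N d σ = diagramOp q N d (fun τ => if τ = [] then 1 else 0) σ := by
  induction d generalizing σ with
  | nil => rfl
  | cons s d ih =>
    rw [diagramOp_cons, Module.End.mul_apply]
    rw [sliceOp_apply]
    cases s with
    | cup x b => simp only [stateSumFrom, sliceFun, ih]
    | cap x => simp only [stateSumFrom, sliceFun, ih]
    | cross x o => simp only [stateSumFrom, sliceFun, ih]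

theorem sliceOp_cup_zero (b : Bool) (f : List (Bool × Fin N) → F) (σ : List (Bool × Fin N)) :
    sliceOp q N (.cup 0 b) f σ = ∑ i, cupWeight q b i * f ((b, i) :: (!b, i) :: σ) := by
  rw [sliceOp_apply]
  simp [sliceFun]

theorem sliceOp_cap_zero (f : List (Bool × Fin N) → F) (s t : Bool × Fin N)
    (σ : List (Bool × Fin N)) :
    sliceOp q N (.cap 0) f (s :: t :: σ) =
      (if s.1 ≠ t.1 ∧ s.2 = t.2 then capWeight q s.1 s.2 else 0) * f σ := by
  rw [sliceOp_apply]
  simp [sliceFun]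

theorem sliceOp_cross_zero (o : Bool) (f : List (Bool × Fin N) → F) (s t : Bool × Fin N)
    (σ : List (Bool × Fin N)) :
    sliceOp q N (.cross 0 o) f (s :: t :: σ) =
      ∑ k, ∑ l, crossWeight q o s.1 t.1 s.2 t.2 k l * f ((t.1, k) :: (s.1, l) :: σ) := by
  rw [sliceOp_apply]
  simp [sliceFun]

/-- The position of a slice. -/
def _root_.Slice.pos : Slice → ℕ
  | .cup x _ => x
  | .cap x => x
  | .cross x _ => x

/-- The number of strands that a slice consumes. -/
def _root_.Slice.arity : Slice → ℕ
  | .cup _ _ => 0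
  | .cap _ => 2
  | .cross _ _ => 2

/-- A slice moved to the right by `k` strands. -/
def _root_.Slice.shift (k : ℕ) : Slice → Slice
  | .cup x b => .cup (k + x) b
  | .cap x => .cap (k + x)
  | .cross x o => .cross (k + x) o

/-- The value on lists that are too short is a convention, but it has to be known: operator
identities are claimed on all lists, so these cases must agree as well. -/
theorem sliceOp_of_length_lt (s : Slice) (f : List (Bool × Fin N) → F) (σ : List (Bool × Fin N))
    (h : σ.length < s.pos + s.arity) : sliceOp q N s f σ = 0 := by
  rw [sliceOp_apply]
  cases s with
  | cup x b => simp only [Slice.pos, Slice.arity] at h; simp only [sliceFun]; rw [if_neg (by omega)]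
  | cap x =>
    simp only [Slice.pos, Slice.arity] at h; simp only [sliceFun]
    split
    · rename_i heq; have := congrArg List.length heq; simp at this; omega
    · rfl
  | cross x o =>
    simp only [Slice.pos, Slice.arity] at h; simp only [sliceFun]
    split
    · rename_i heq; have := congrArg List.length heq; simp at this; omega
    · rfl

/-- Locality: the strands on the left of a slice are spectators. -/
theorem sliceOp_shift (s : Slice) (f : List (Bool × Fin N) → F) (u v : List (Bool × Fin N)) :
    sliceOp q N (s.shift u.length) f (u ++ v) = sliceOp q N s (fun w => f (u ++ w)) v := by
  rw [sliceOp_apply, sliceOp_apply]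
  have ht : ∀ x, (u ++ v).take (u.length + x) = u ++ v.take x := fun x => by
    simp [List.take_append, List.take_of_length_le]
  have hd : ∀ x, (u ++ v).drop (u.length + x) = v.drop x := fun x => by
    simp [List.drop_append]
  cases s with
  | cup x b => simp [Slice.shift, sliceFun, ht, hd]
  | cap x => simp [Slice.shift, sliceFun, ht, hd]
  | cross x o => simp [Slice.shift, sliceFun, ht, hd]

theorem sliceOp_shift_one (s : Slice) (f : List (Bool × Fin N) → F) (u : Bool × Fin N)
    (v : List (Bool × Fin N)) :
    sliceOp q N (s.shift 1) f (u :: v) = sliceOp q N s (fun w => f (u :: w)) v :=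
  sliceOp_shift q s f [u] v

theorem sliceOp_shift_two (s : Slice) (f : List (Bool × Fin N) → F) (t u : Bool × Fin N)
    (v : List (Bool × Fin N)) :
    sliceOp q N (s.shift 2) f (t :: u :: v) = sliceOp q N s (fun w => f (t :: u :: w)) v :=
  sliceOp_shift q s f [t, u] v

theorem diagramOp_shift (d : List Slice) (f : List (Bool × Fin N) → F)
    (u v : List (Bool × Fin N)) :
    diagramOp q N (d.map (Slice.shift u.length)) f (u ++ v) =
      diagramOp q N d (fun w => f (u ++ w)) v := by
  induction d generalizing v with
  | nil => rfl
  | cons s d ih =>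
    simp only [List.map_cons, diagramOp_cons, Module.End.mul_apply]
    rw [sliceOp_shift]
    have : (fun w => diagramOp q N (d.map (Slice.shift u.length)) f (u ++ w)) =
        diagramOp q N d fun w => f (u ++ w) := funext ih
    rw [this]

theorem diagramOp_shift_of_length_lt (k : ℕ) (d : List Slice) (hd : d ≠ [])
    (f : List (Bool × Fin N) → F) (σ : List (Bool × Fin N)) (h : σ.length < k) :
    diagramOp q N (d.map (Slice.shift k)) f σ = 0 := by
  cases d with
  | nil => exact absurd rfl hd
  | cons s d =>
    simp only [List.map_cons, diagramOp_cons, Module.End.mul_apply]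
    apply sliceOp_of_length_lt
    cases s <;> simp [Slice.shift, Slice.pos, Slice.arity] <;> omega

theorem exists_append_of_le_length {α : Type*} {σ : List α} {k : ℕ} (h : k ≤ σ.length) :
    ∃ u v, σ = u ++ v ∧ u.length = k :=
  ⟨σ.take k, σ.drop k, by simp, by simpa using h⟩

/-- This carries a move proved at position 0 to every position. Both diagrams must be nonempty: the
empty diagram is the identity, which does not vanish on lists shorter than `k`. -/
theorem diagramOp_shift_smul_congr {d d' : List Slice} (hd : d ≠ []) (hd' : d' ≠ []) (c : F)
    (h : diagramOp q N d = c • diagramOp q N d') (k : ℕ) :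
    diagramOp q N (d.map (Slice.shift k)) = c • diagramOp q N (d'.map (Slice.shift k)) := by
  ext f σ
  simp only [LinearMap.smul_apply, Pi.smul_apply]
  rcases Nat.lt_or_ge σ.length k with hk | hk
  · rw [diagramOp_shift_of_length_lt q k d hd f σ hk,
      diagramOp_shift_of_length_lt q k d' hd' f σ hk, smul_zero]
  · obtain ⟨u, v, rfl, rfl⟩ := exists_append_of_le_length hk
    rw [diagramOp_shift, diagramOp_shift, h]; rfl

theorem diagramOp_shift_congr {d d' : List Slice} (hd : d ≠ []) (hd' : d' ≠ [])
    (h : diagramOp q N d = diagramOp q N d') (k : ℕ) :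
    diagramOp q N (d.map (Slice.shift k)) = diagramOp q N (d'.map (Slice.shift k)) := by
  rw [diagramOp_shift_smul_congr q hd hd' 1 (by rw [h, one_smul]) k, one_smul]

theorem sliceOp_sum {ι : Type*} (I : Finset ι) (s : Slice) (c : ι → F)
    (f : ι → List (Bool × Fin N) → F) (σ : List (Bool × Fin N)) :
    sliceOp q N s (fun τ => ∑ i ∈ I, c i * f i τ) σ = ∑ i ∈ I, c i * sliceOp q N s (f i) σ := by
  have : (fun τ => ∑ i ∈ I, c i * f i τ) = ∑ i ∈ I, c i • f i := by
    funext τ; simp [Finset.sum_apply]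
  rw [this, map_sum]
  simp [Finset.sum_apply]

theorem sliceOp_const_mul (s : Slice) (c : F) (f : List (Bool × Fin N) → F)
    (σ : List (Bool × Fin N)) :
    sliceOp q N s (fun τ => c * f τ) σ = c * sliceOp q N s f σ := by
  have : (fun τ => c * f τ) = c • f := rfl
  rw [this, map_smul]; rfl

/-! ### Distant slices commute -/

theorem cup_zero_mul_shift (b : Bool) (s : Slice) :
    sliceOp q N (.cup 0 b) * sliceOp q N (s.shift 2) =
      sliceOp q N s * sliceOp q N (.cup 0 b) := by
  ext f σ
  simp only [Module.End.mul_apply]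
  rw [sliceOp_cup_zero]
  simp only [sliceOp_shift_two]
  rw [← sliceOp_sum]
  have : (fun τ => ∑ i, cupWeight q b i * f ((b, i) :: (!b, i) :: τ)) =
      sliceOp q N (.cup 0 b) f := by
    funext τ; rw [sliceOp_cup_zero]
  rw [this]

theorem shift_mul_cap_zero (s : Slice) :
    sliceOp q N (s.shift 2) * sliceOp q N (.cap 0) = sliceOp q N (.cap 0) * sliceOp q N s := by
  ext f σ
  simp only [Module.End.mul_apply]
  match σ with
  | [] | [_] =>
    rw [sliceOp_of_length_lt, sliceOp_of_length_lt] <;>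
      cases s <;> simp [Slice.shift, Slice.pos, Slice.arity] <;> omega
  | t :: u :: v =>
    rw [sliceOp_shift_two, sliceOp_cap_zero]
    simp only [sliceOp_cap_zero, sliceOp_const_mul]

theorem cross_zero_mul_shift (o : Bool) (s : Slice) :
    sliceOp q N (.cross 0 o) * sliceOp q N (s.shift 2) =
      sliceOp q N (s.shift 2) * sliceOp q N (.cross 0 o) := by
  ext f σ
  simp only [Module.End.mul_apply]
  match σ with
  | [] | [_] =>
    rw [sliceOp_of_length_lt, sliceOp_of_length_lt] <;>
      cases s <;> simp [Slice.shift, Slice.pos, Slice.arity] <;> omega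
  | t :: u :: v =>
    rw [sliceOp_shift_two, sliceOp_cross_zero]
    simp only [sliceOp_cross_zero, sliceOp_shift_two]
    simp only [← Fintype.sum_prod_type', sliceOp_sum]

end Operators

end LinkDiagram

/-! ### Local moves of the weights -/

namespace LinkDiagram

section Weights

variable {F : Type*} [Field F] (q : F) {N : ℕ}

theorem colourWeight_ne_zero (hq : q ≠ 0) (i : Fin N) : colourWeight q i ≠ 0 :=
  zpow_ne_zero _ hq

/-- Crossings with downward strands are defined as rotations of upward ones, so sliding around a cap
leaves the sign and changes which diagonal lies over: `o` becomes `!o`. What remains is a finite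
comparison of entries. -/
theorem crossWeight_rotate_cap (hq : q ≠ 0) (o a b : Bool) (i j k m : Fin N) :
    crossWeight q o a b i j m k * capWeight q a k =
      crossWeight q (!o) b (!a) j k i m * capWeight q a i := by
  have h := colourWeight_ne_zero q hq (N := N)
  cases a <;> cases b <;> cases o <;>
    simp only [crossWeight, positiveCrossing, capWeight, cupWeight, rMatrix] <;>
    (try simp only [beq_self_eq_true, Bool.not_true, Bool.not_false, if_true,
      if_false, Bool.false_eq_true, beq_iff_eq, mul_one, one_mul]) <;>
    split_ifs <;> grind

theorem crossWeight_rotate_cup (hq : q ≠ 0) (o a b : Bool) (i k l m : Fin N) :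
    cupWeight q b m * crossWeight q o (!b) a m i k l =
      cupWeight q b l * crossWeight q (!o) a b i l m k := by
  have h := colourWeight_ne_zero q hq (N := N)
  cases a <;> cases b <;> cases o <;>
    simp only [crossWeight, positiveCrossing, capWeight, cupWeight, rMatrix] <;>
    (try simp only [beq_self_eq_true, Bool.not_true, Bool.not_false, if_true,
      if_false, Bool.false_eq_true, beq_iff_eq, mul_one, one_mul]) <;>
    split_ifs <;> grind

/-- The coefficient of the identity in a crossing of two parallel strands. -/
def parallelCoeff (o a : Bool) (i j : Fin N) : F :=
  if o then (if (if a then j < i else i < j) then q - q⁻¹ else 0)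
  else (if (if a then i < j else j < i) then -(q - q⁻¹) else 0)

theorem crossWeight_parallel (o a : Bool) (i j k l : Fin N) :
    crossWeight q o a a i j k l =
      if i = j then (if k = i ∧ l = i then (if o then q else q⁻¹) else 0)
      else (if k = j ∧ l = i then 1 else 0) +
        (if k = i ∧ l = j then parallelCoeff q o a i j else 0) := by
  cases a <;> cases o <;>
    simp only [crossWeight, positiveCrossing, rMatrix, parallelCoeff] <;>
    (try simp only [beq_self_eq_true, if_true,
      if_false, Bool.false_eq_true, beq_iff_eq]) <;>
    split_ifs <;> grind

/-- The part of a crossing of two anti-parallel strands that changes the colours. -/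
def antiparallelCoeff (o a : Bool) (i k : Fin N) : F :=
  if i = k then (if o then q⁻¹ else q)
  else if (if o = a then k < i else i < k) then
    (if o then -(q - q⁻¹) else q - q⁻¹) * (if a then colourWeight q i * (colourWeight q k)⁻¹ else 1)
  else 0

set_option maxHeartbeats 1000000 in
-- Colours are conserved: different colours follow their strands with weight 1, whereas equal
-- colours on anti-parallel strands can annihilate and reappear as another pair. Hence only a matrix
-- indexed by two colours is nontrivial.
theorem crossWeight_antiparallel (hq : q ≠ 0) (o a : Bool) (i j k l : Fin N) :
    crossWeight q o a (!a) i j k l =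
      if i = j then (if k = l then antiparallelCoeff q o a i k else 0)
      else if k = j ∧ l = i then 1 else 0 := by
  have h := colourWeight_ne_zero q hq (N := N)
  cases a <;> cases o <;>
    simp only [crossWeight, positiveCrossing, rMatrix, antiparallelCoeff, capWeight, cupWeight] <;>
    (try simp only [if_true, Bool.not_true, Bool.not_false, mul_one, one_mul,
      if_false, Bool.false_eq_true, beq_iff_eq]) <;>
    split_ifs <;> grind

/-- This is R - R⁻¹ = q - q⁻¹ turned by a quarter: the rotated identity is a cap followed by a cup.
-/
theorem crossWeight_skein (hq : q ≠ 0) (a : Bool) (i j k l : Fin N) :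
    crossWeight q false a (!a) i j k l = crossWeight q true a (!a) i j k l +
      (q - q⁻¹) * ((if i = j then capWeight q a i else 0) *
        (if k = l then cupWeight q (!a) k else 0)) := by
  have h := colourWeight_ne_zero q hq (N := N)
  rw [crossWeight_antiparallel q hq, crossWeight_antiparallel q hq]
  cases a <;> simp only [antiparallelCoeff, capWeight, cupWeight] <;>
    (try simp only [Bool.not_true, Bool.not_false, mul_one,
      if_false, if_true, Bool.false_eq_true]) <;>
    split_ifs <;> grind

theorem sum_telescope (h : ℕ → F) (a b : ℕ) (hab : a ≤ b) (hb : b ≤ N) :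
    ∑ k : Fin N, (if a ≤ k ∧ k < b then h (k + 1) - h k else 0) = h b - h a := by
  rw [Fin.sum_univ_eq_sum_range (fun k => if a ≤ k ∧ k < b then h (k + 1) - h k else 0) N,
    ← Finset.sum_filter]
  have : (Finset.range N).filter (fun k => a ≤ k ∧ k < b) = Finset.Ico a b := by
    ext k; simp; omega
  rw [this, Finset.sum_Ico_eq_sub _ hab, Finset.sum_range_sub, Finset.sum_range_sub]
  ring

/-- The matrix preserves the span of the colour pairs (i, j) and (j, i), so inverting it is a
computation in blocks of size at most two. -/
theorem sum_crossWeight_parallel (hq : q ≠ 0) (o a : Bool) (i j m n : Fin N) :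
    ∑ k, ∑ l, crossWeight q o a a i j k l * crossWeight q (!o) a a k l m n =
      if m = i ∧ n = j then 1 else 0 := by
  -- Only one or two terms of the double sum survive, whatever the second factor is.
  have key : ∀ g : Fin N → Fin N → F, ∑ k, ∑ l, crossWeight q o a a i j k l * g k l =
      if i = j then (if o then q else q⁻¹) * g i i
      else g j i + parallelCoeff q o a i j * g i j := by
    intro g
    simp only [crossWeight_parallel]
    split_ifs with h <;>
      simp [add_mul, Finset.sum_add_distrib, ite_and, ite_mul]
  rw [key]
  simp only [crossWeight_parallel, parallelCoeff]
  cases a <;> cases o <;> simp only [Bool.not_true, Bool.not_false,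
      if_false, if_true, Bool.false_eq_true] <;> split_ifs <;> grind

end Weights

end LinkDiagram

/-! ### Geometric sums over colours: Reidemeister moves and the quantum dimension -/

namespace LinkDiagram

section Weights

variable {F : Type*} [Field F] (q : F) {N : ℕ}

theorem sum_zpow_two_mul (hq : q ≠ 0) (a b : ℕ) (hab : a ≤ b) (hb : b ≤ N) :
    ∑ k : Fin N, (if a ≤ k ∧ k < b then (q - q⁻¹) * q ^ (2 * (k : ℤ)) else 0) =
      q ^ (2 * (b : ℤ) - 1) - q ^ (2 * (a : ℤ) - 1) := by
  rw [← sum_telescope (fun k => q ^ (2 * (k : ℤ) - 1)) a b hab hb]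
  refine Finset.sum_congr rfl fun k _ => ?_
  split_ifs
  · have : 2 * (((k : ℕ) + 1 : ℕ) : ℤ) - 1 = 2 * (k : ℤ) + 1 := by push_cast; ring
    rw [this, zpow_add_one₀ hq, zpow_sub_one₀ hq]; ring
  · rfl

/-- The previous sum with q⁻¹ in place of q, which also changes the sign of q - q⁻¹. -/
theorem sum_zpow_neg_two_mul (hq : q ≠ 0) (a b : ℕ) (hab : a ≤ b) (hb : b ≤ N) :
    ∑ k : Fin N, (if a ≤ k ∧ k < b then (q - q⁻¹) * q ^ (-2 * (k : ℤ)) else 0) =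
      q ^ (1 - 2 * (a : ℤ)) - q ^ (1 - 2 * (b : ℤ)) := by
  have h := sum_zpow_two_mul q⁻¹ (inv_ne_zero hq) a b hab hb
  have e : ∀ m : ℤ, q⁻¹ ^ m = q ^ (-m) := fun m => by rw [inv_zpow, zpow_neg]
  simp only [e, inv_inv] at h
  have h2 : q ^ (1 - 2 * (a : ℤ)) - q ^ (1 - 2 * (b : ℤ)) =
      -(q ^ (-(2 * (b : ℤ) - 1)) - q ^ (-(2 * (a : ℤ) - 1))) := by
    simp only [neg_sub]
  rw [h2, ← h, ← Finset.sum_neg_distrib]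
  refine Finset.sum_congr rfl fun k _ => ?_
  split_ifs
  · rw [neg_mul]; ring
  · simp

theorem sum_antiparallelCoeff_mul (o a : Bool) (i : Fin N) (g : Fin N → F) :
    ∑ k, antiparallelCoeff q o a i k * g k = (if o then q⁻¹ else q) * g i +
      ∑ k, (if (if o = a then k < i else i < k) then
        (if o then -(q - q⁻¹) else q - q⁻¹) *
          (if a then colourWeight q i * (colourWeight q k)⁻¹ else 1) * g k else 0) := by
  have : (if o then q⁻¹ else q) * g i = ∑ k, if k = i then (if o then q⁻¹ else q) * g i else 0 := by
    simp
  rw [this, ← Finset.sum_add_distrib]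
  refine Finset.sum_congr rfl fun k _ => ?_
  simp only [antiparallelCoeff]
  rcases lt_trichotomy i k with h | rfl | h
  · cases o <;> cases a <;> simp [h, h.ne, h.ne', h.not_gt]
  · simp
  · cases o <;> cases a <;> simp [h, h.ne, h.ne', h.not_gt]

theorem colourWeight_mul_inv (hq : q ≠ 0) (i k : Fin N) :
    colourWeight q i * (colourWeight q k)⁻¹ = q ^ (-2 * (i : ℤ)) * q ^ (2 * (k : ℤ)) := by
  rw [colourWeight, colourWeight, ← zpow_neg, ← zpow_add₀ hq, ← zpow_add₀ hq]
  congr 1; ring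

theorem colourWeight_eq (hq : q ≠ 0) (i : Fin N) :
    colourWeight q i = q ^ ((N : ℤ) - 1) * q ^ (-2 * (i : ℤ)) := by
  rw [colourWeight, ← zpow_add₀ hq]; congr 1

/-- The numerical content of the first Reidemeister move. The off-diagonal terms form a geometric
series over the colours on one side of `i`; one end of the telescoped sum cancels the diagonal term,
and the other yields the framing factor. -/
theorem sum_antiparallelCoeff_mul_capWeight (hq : q ≠ 0) (o a : Bool) (i : Fin N) :
    ∑ k, antiparallelCoeff q o a i k * capWeight q (!a) k =
      (if o then (q ^ N)⁻¹ else q ^ N) * capWeight q a i := by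
  have hi := i.isLt
  have up := sum_zpow_two_mul q hq (N := N) (i + 1) N hi le_rfl
  have dn := sum_zpow_two_mul q hq (N := N) 0 i (by omega) hi.le
  have up' := sum_zpow_neg_two_mul q hq (N := N) (i + 1) N hi le_rfl
  have dn' := sum_zpow_neg_two_mul q hq (N := N) 0 i (by omega) hi.le
  have c1 : ∀ k : Fin N, ((i : ℕ) + 1 ≤ k ∧ (k : ℕ) < N) ↔ i < k := fun k => by
    rw [Fin.lt_def]; omega
  have c2 : ∀ k : Fin N, (0 ≤ (k : ℕ) ∧ (k : ℕ) < i) ↔ k < i := fun k => by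
    rw [Fin.lt_def]; omega
  simp only [c1] at up up'
  simp only [c2] at dn dn'
  have hz : ∀ m : ℤ, q ^ m ≠ 0 := fun m => zpow_ne_zero _ hq
  rw [sum_antiparallelCoeff_mul]
  have exp2' : ∀ m : ℤ, q ^ (2 * m) = (q ^ m) ^ 2 := fun m => by
    rw [← zpow_natCast, ← zpow_mul]; congr 1; push_cast; ring
  cases o <;> cases a
  · have : ∀ k : Fin N, (if k < i then (q - q⁻¹) * 1 * colourWeight q k else 0) =
        q ^ ((N : ℤ) - 1) * (if k < i then (q - q⁻¹) * q ^ (-2 * (k : ℤ)) else 0) := fun k => by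
      rw [colourWeight_eq q hq]; split_ifs <;> ring
    simp only [capWeight, Bool.not_false, Bool.false_eq_true, if_true, if_false, this]
    rw [← Finset.mul_sum, dn', colourWeight_eq q hq]
    simp only [sub_eq_add_neg, zpow_add₀ hq, zpow_neg, zpow_natCast, zpow_one,
        exp2', neg_mul]
    field_simp
    simp
  · have : ∀ k : Fin N, (if i < k then (q - q⁻¹) *
          (colourWeight q i * (colourWeight q k)⁻¹) * 1 else 0) =
        q ^ (-2 * (i : ℤ)) * (if i < k then (q - q⁻¹) * q ^ (2 * (k : ℤ)) else 0) := fun k => by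
      rw [colourWeight_mul_inv q hq]; split_ifs <;> ring
    simp only [capWeight, Bool.not_true, Bool.false_eq_true, if_true, if_false, this]
    rw [← Finset.mul_sum, up, colourWeight_eq q hq]
    push_cast
    simp only [mul_add, sub_eq_add_neg, zpow_add₀ hq, zpow_neg, zpow_natCast, zpow_one,
        exp2', neg_mul]
    field_simp
    ring
  · have : ∀ k : Fin N, (if i < k then -(q - q⁻¹) * 1 * colourWeight q k else 0) =
        -q ^ ((N : ℤ) - 1) * (if i < k then (q - q⁻¹) * q ^ (-2 * (k : ℤ)) else 0) := fun k => by
      rw [colourWeight_eq q hq]; split_ifs <;> ring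
    simp only [capWeight, Bool.not_false, Bool.false_eq_true, if_true, if_false, this,
      reduceCtorEq]
    rw [← Finset.mul_sum, up', colourWeight_eq q hq]
    push_cast
    simp only [mul_add, sub_eq_add_neg, zpow_add₀ hq, zpow_neg, zpow_natCast, zpow_one,
        exp2', neg_mul]
    field_simp
    ring
  · have : ∀ k : Fin N, (if k < i then -(q - q⁻¹) *
          (colourWeight q i * (colourWeight q k)⁻¹) * 1 else 0) =
        -q ^ (-2 * (i : ℤ)) * (if k < i then (q - q⁻¹) * q ^ (2 * (k : ℤ)) else 0) := fun k => by
      rw [colourWeight_mul_inv q hq]; split_ifs <;> ring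
    simp only [capWeight, Bool.not_true, Bool.false_eq_true, if_true, if_false, this]
    rw [← Finset.mul_sum, dn, colourWeight_eq q hq]
    simp only [sub_eq_add_neg, zpow_add₀ hq, zpow_neg, zpow_natCast, zpow_one,
        exp2', neg_mul]
    field_simp
    simp

/-- Both matrices are triangular in the same direction, so only k = i, k = m and the k strictly
between contribute. For i = m the product is q · q⁻¹; otherwise the geometric sum over the
intermediate colours cancels the two end terms. -/
theorem sum_antiparallelCoeff_mul_antiparallelCoeff (hq : q ≠ 0) (o a : Bool) (i m : Fin N) :
    ∑ k, antiparallelCoeff q o a i k * antiparallelCoeff q (!o) (!a) k m =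
      if i = m then 1 else 0 := by
  have hz : ∀ m : ℤ, q ^ m ≠ 0 := fun m => zpow_ne_zero _ hq
  have exp2' : ∀ m : ℤ, q ^ (2 * m) = (q ^ m) ^ 2 := fun m => by
    rw [← zpow_natCast, ← zpow_mul]; congr 1; push_cast; ring
  have c : ∀ i m k : Fin N, ((i : ℕ) + 1 ≤ k ∧ (k : ℕ) < m) ↔ i < k ∧ k < m := fun i m k => by
    rw [Fin.lt_def, Fin.lt_def]; omega
  -- The term k = m is separated from the intermediate ones, in which the dependence on k is reduced
  -- to a single power of q.
  have split : ∀ k, (if (if o = a then k < i else i < k) then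
        (if o then -(q - q⁻¹) else q - q⁻¹) *
          (if a then colourWeight q i * (colourWeight q k)⁻¹ else 1) *
          antiparallelCoeff q (!o) (!a) k m else 0) =
      (if k = m then (if (if o = a then k < i else i < k) then
        (if o then -(q - q⁻¹) else q - q⁻¹) *
          (if a then colourWeight q i * (colourWeight q k)⁻¹ else 1) *
          (if o then q else q⁻¹) else 0) else 0) +
      (if (if o = a then k < i ∧ m < k else i < k ∧ k < m) then
        -(q - q⁻¹) * (if a then q ^ (-2 * (i : ℤ)) else q ^ (2 * (m : ℤ))) *
          ((q - q⁻¹) * (if a then q ^ (2 * (k : ℤ)) else q ^ (-2 * (k : ℤ)))) else 0) := by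
    intro k
    simp only [antiparallelCoeff, colourWeight_mul_inv q hq]
    rcases lt_trichotomy k m with h | rfl | h
    · cases o <;> cases a <;> simp [h, h.ne, h.not_gt] <;> split_ifs <;> ring
    · cases o <;> cases a <;> simp
    · cases o <;> cases a <;> simp [h, h.ne', h.not_gt] <;> split_ifs <;> ring
  rw [sum_antiparallelCoeff_mul]
  simp only [split, Finset.sum_add_distrib, Finset.sum_ite_eq', Finset.mem_univ, if_true]
  simp only [antiparallelCoeff, colourWeight_mul_inv q hq]
  have zero : ∀ (P : Fin N → Prop) [DecidablePred P] (f : Fin N → F), (∀ k, ¬ P k) →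
      ∑ k, (if P k then f k else 0) = 0 := fun P _ f h =>
    Finset.sum_eq_zero fun k _ => if_neg (h k)
  have pull : ∀ (P : Fin N → Prop) [DecidablePred P] (c : F) (f : Fin N → F),
      ∑ k, (if P k then c * f k else 0) = c * ∑ k, if P k then f k else 0 := fun P _ c f => by
    rw [Finset.mul_sum]; exact Finset.sum_congr rfl fun k _ => by split_ifs <;> simp
  rw [pull]
  rcases lt_trichotomy i m with h | rfl | h
  · have up := sum_zpow_two_mul q hq (N := N) (i + 1) m h m.isLt.le
    have dn := sum_zpow_neg_two_mul q hq (N := N) (i + 1) m h m.isLt.le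
    simp only [c] at up dn
    have z := fun f => zero (fun k => k < i ∧ m < k) f fun k hk => by omega
    cases o <;> cases a <;>
      simp only [h, h.ne, h.not_gt, up, dn, z, Bool.not_true, Bool.not_false, if_true,
        if_false, Bool.false_eq_true, reduceCtorEq, mul_zero, add_zero] <;>
      push_cast <;>
      simp only [mul_add, sub_eq_add_neg, zpow_add₀ hq, zpow_neg, zpow_natCast, zpow_one,
        exp2', neg_mul] <;>
      field_simp <;> ring
  · have z := fun f => zero (fun k => k < i ∧ i < k) f fun k hk => by omega
    have z' := fun f => zero (fun k => i < k ∧ k < i) f fun k hk => by omega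
    cases o <;> cases a <;> simp [z, z', hq]
  · have up := sum_zpow_two_mul q hq (N := N) (m + 1) i h i.isLt.le
    have dn := sum_zpow_neg_two_mul q hq (N := N) (m + 1) i h i.isLt.le
    simp only [c] at up dn
    simp only [and_comm (b := (_ < i))] at up dn
    have z := fun f => zero (fun k => i < k ∧ k < m) f fun k hk => by omega
    cases o <;> cases a <;>
      simp only [h, h.ne', h.not_gt, up, dn, z, Bool.not_true, Bool.not_false, if_true,
        if_false, Bool.false_eq_true, reduceCtorEq, mul_zero, add_zero] <;>
      push_cast <;>
      simp only [mul_add, sub_eq_add_neg, zpow_add₀ hq, zpow_neg, zpow_natCast, zpow_one,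
        exp2', neg_mul] <;>
      field_simp <;> ring

theorem sum_crossWeight_mul_crossWeight (hq : q ≠ 0) (o a b : Bool) (i j m n : Fin N) :
    ∑ k, ∑ l, crossWeight q o a b i j k l * crossWeight q (!o) b a k l m n =
      if m = i ∧ n = j then 1 else 0 := by
  by_cases hab : b = a
  · subst hab; exact sum_crossWeight_parallel q hq o b i j m n
  · obtain rfl : b = !a := by cases a <;> cases b <;> simp_all
    have key : ∀ g : Fin N → Fin N → F, ∑ k, ∑ l, crossWeight q o a (!a) i j k l * g k l =
        if i = j then ∑ k, antiparallelCoeff q o a i k * g k k else g j i := by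
      intro g
      simp only [crossWeight_antiparallel q hq]
      split_ifs with h <;> simp [ite_and]
    rw [key]
    have h2 : ∀ k l, crossWeight q (!o) (!a) a k l m n = if k = l then
        (if m = n then antiparallelCoeff q (!o) (!a) k m else 0)
        else if m = l ∧ n = k then 1 else 0 := fun k l => by
      have := crossWeight_antiparallel q hq (!o) (!a) k l m n
      rwa [Bool.not_not] at this
    simp only [h2, if_true]
    by_cases h : i = j
    · subst h
      by_cases h3 : m = n
      · subst h3
        simp only [if_true, sum_antiparallelCoeff_mul_antiparallelCoeff q hq, and_self, eq_comm]
      · simp only [if_true, if_neg h3, mul_zero, Finset.sum_const_zero]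
        rw [if_neg (by rintro ⟨rfl, rfl⟩; exact h3 rfl)]
    · rw [if_neg h, if_neg (Ne.symm h)]

theorem sum_crossWeight_mul_capWeight (hq : q ≠ 0) (o a : Bool) (i j : Fin N) :
    ∑ k, crossWeight q o a (!a) i j k k * capWeight q (!a) k =
      if i = j then (if o then (q ^ N)⁻¹ else q ^ N) * capWeight q a i else 0 := by
  simp only [crossWeight_antiparallel q hq, if_true]
  split_ifs with h
  · rw [sum_antiparallelCoeff_mul_capWeight q hq]; simp_all
  · rw [sum_antiparallelCoeff_mul_capWeight q hq]; simp_all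
  · refine Finset.sum_eq_zero fun k _ => ?_
    rw [if_neg (by rintro ⟨rfl, rfl⟩; exact h rfl), zero_mul]

theorem sum_colourWeight (hq : q ≠ 0) (hq' : q - q⁻¹ ≠ 0) :
    ∑ i : Fin N, colourWeight q i = dimAt q N := by
  have h := sum_zpow_neg_two_mul q hq (N := N) 0 N (Nat.zero_le _) le_rfl
  simp only [Nat.zero_le, Fin.is_lt, and_self, if_true, ← Finset.mul_sum] at h
  simp only [colourWeight_eq q hq, ← Finset.mul_sum]
  rw [dimAt, eq_div_iff hq']
  rw [mul_assoc, mul_comm _ (q - q⁻¹), h]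
  have e : q ^ (2 * (N : ℤ)) = (q ^ N) ^ 2 := by
    rw [← zpow_natCast, ← zpow_natCast, ← zpow_mul]; congr 1; push_cast; ring
  push_cast
  simp only [sub_eq_add_neg, zpow_add₀ hq, zpow_neg, zpow_natCast, zpow_one, e]
  field_simp

theorem sum_cupWeight_mul_capWeight (hq : q ≠ 0) (hq' : q - q⁻¹ ≠ 0) (b : Bool) :
    ∑ i : Fin N, cupWeight q b i * capWeight q b i = dimAt q N := by
  cases b
  -- Reversing the order of the colours inverts the weights, so both orientations of the circle have
  -- the same value.
  · have e : ∀ i : Fin N, (colourWeight q i)⁻¹ = colourWeight q (Fin.rev i) := fun i => by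
      rw [colourWeight, colourWeight, ← zpow_neg, Fin.val_rev]
      congr 1
      have := i.isLt
      push_cast [Nat.cast_sub (show (i : ℕ) + 1 ≤ N by omega)]; ring
    simp only [cupWeight, capWeight, Bool.false_eq_true, if_false, mul_one, e]
    rw [← sum_colourWeight q hq hq', ← Equiv.sum_comp Fin.revPerm]
    simp only [Fin.revPerm_apply, Fin.rev_rev]
  · simp [cupWeight, capWeight, sum_colourWeight q hq hq']

end Weights

end LinkDiagram

/-! ### Local moves of diagrams -/

namespace LinkDiagram

section Moves

variable {F : Type*} [Field F] (q : F) (N : ℕ)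

theorem exists_eq_shift (x : ℕ) (s : Slice) (h : x ≤ s.pos) : ∃ t : Slice, s = t.shift x := by
  cases s with
  | cup y b => exact ⟨.cup (y - x) b, by simp only [Slice.pos] at h; simp [Slice.shift, h]⟩
  | cap y => exact ⟨.cap (y - x), by simp only [Slice.pos] at h; simp [Slice.shift, h]⟩
  | cross y o => exact ⟨.cross (y - x) o, by simp only [Slice.pos] at h; simp [Slice.shift, h]⟩

theorem shift_shift (x y : ℕ) (s : Slice) : (s.shift x).shift y = s.shift (y + x) := by
  cases s <;> simp [Slice.shift, add_assoc]

theorem shift_comm (x y : ℕ) (s : Slice) : (s.shift x).shift y = (s.shift y).shift x := by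
  rw [shift_shift, shift_shift, add_comm]

theorem pair_shift_congr {s t s' t' : Slice}
    (h : sliceOp q N s * sliceOp q N t = sliceOp q N s' * sliceOp q N t') (x : ℕ) :
    sliceOp q N (s.shift x) * sliceOp q N (t.shift x) =
      sliceOp q N (s'.shift x) * sliceOp q N (t'.shift x) := by
  simpa [diagramOp] using diagramOp_shift_congr q (d := [s, t]) (d' := [s', t'])
    (List.cons_ne_nil _ _) (List.cons_ne_nil _ _) (by simpa [diagramOp] using h) x

/-- A cup commutes with the slices on its right. -/
theorem cup_mul_shift (x : ℕ) (b : Bool) (s : Slice) (h : x ≤ s.pos) :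
    sliceOp q N (.cup x b) * sliceOp q N (s.shift 2) =
      sliceOp q N s * sliceOp q N (.cup x b) := by
  obtain ⟨t, rfl⟩ := exists_eq_shift x s h
  rw [shift_comm]
  exact pair_shift_congr q N (cup_zero_mul_shift q b t) x

/-- A cap commutes with the slices on its right. -/
theorem shift_mul_cap (x : ℕ) (s : Slice) (h : x ≤ s.pos) :
    sliceOp q N (s.shift 2) * sliceOp q N (.cap x) = sliceOp q N (.cap x) * sliceOp q N s := by
  obtain ⟨t, rfl⟩ := exists_eq_shift x s h
  rw [shift_comm]
  exact pair_shift_congr q N (shift_mul_cap_zero q t) x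

/-- A crossing commutes with the slices on its right. -/
theorem cross_mul_shift (x : ℕ) (o : Bool) (s : Slice) (h : x ≤ s.pos) :
    sliceOp q N (.cross x o) * sliceOp q N (s.shift 2) =
      sliceOp q N (s.shift 2) * sliceOp q N (.cross x o) := by
  obtain ⟨t, rfl⟩ := exists_eq_shift x s h
  rw [shift_comm]
  exact pair_shift_congr q N (cross_zero_mul_shift q o t) x

theorem cup_mul_map_shift (x : ℕ) (b : Bool) (d : List Slice) (h : ∀ s ∈ d, x ≤ s.pos) :
    sliceOp q N (.cup x b) * diagramOp q N (d.map (Slice.shift 2)) =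
      diagramOp q N d * sliceOp q N (.cup x b) := by
  induction d with
  | nil => simp
  | cons s d ih =>
    simp only [List.map_cons, diagramOp_cons]
    rw [← mul_assoc, cup_mul_shift q N x b s (h s (by simp)), mul_assoc,
      ih fun t ht => h t (by simp [ht]), mul_assoc]

variable {q} (hq : q ≠ 0)
include hq

/-- A crossing slides around a cap. -/
theorem cross_mul_cap (x : ℕ) (o : Bool) :
    sliceOp q N (.cross x o) * sliceOp q N (.cap (x + 1)) =
      sliceOp q N (.cross (x + 1) (!o)) * sliceOp q N (.cap x) := by
  refine pair_shift_congr q N (s := .cross 0 o) (t := .cap 1) (s' := .cross 1 (!o)) (t' := .cap 0)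
    ?_ x
  ext f σ
  simp only [Module.End.mul_apply]
  match σ with
  | [] | [_] =>
    rw [sliceOp_of_length_lt, sliceOp_of_length_lt] <;> simp [Slice.pos, Slice.arity]
  | [s, t] =>
    rw [sliceOp_cross_zero, sliceOp_of_length_lt _ (.cross 1 _)]
    · refine Finset.sum_eq_zero fun k _ => Finset.sum_eq_zero fun l _ => ?_
      rw [sliceOp_of_length_lt, mul_zero]
      simp [Slice.pos, Slice.arity]
    · simp [Slice.pos, Slice.arity]
  | (a, i) :: (b, j) :: (c, k) :: r =>
    rw [sliceOp_cross_zero]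
    change _ = sliceOp q N ((Slice.cross 0 (!o)).shift 1) _ _
    rw [sliceOp_shift_one, sliceOp_cross_zero]
    have e : ∀ l m : Fin N, sliceOp q N (.cap 1) f ((b, l) :: (a, m) :: (c, k) :: r) =
        (if a ≠ c ∧ m = k then capWeight q a m else 0) * f ((b, l) :: r) := fun l m => by
      change sliceOp q N ((Slice.cap 0).shift 1) f _ = _
      rw [sliceOp_shift_one, sliceOp_cap_zero]
    simp only [e, sliceOp_cap_zero]
    by_cases hac : a = c
    · simp [hac]
    · obtain rfl : c = !a := by cases a <;> cases c <;> simp_all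
      simp only [ne_eq, Bool.eq_not_self, not_false_eq_true, true_and]
      conv_rhs => rw [Finset.sum_comm]
      simp only [ite_mul, zero_mul, mul_ite, mul_zero, Finset.sum_ite_eq', Finset.sum_ite_eq,
        Finset.mem_univ, if_true]
      refine Finset.sum_congr rfl fun m _ => ?_
      rw [← mul_assoc, ← mul_assoc, crossWeight_rotate_cap q hq]

/-- A crossing slides around a cup. -/
theorem cup_mul_cross (x : ℕ) (b o : Bool) :
    sliceOp q N (.cup x b) * sliceOp q N (.cross (x + 1) o) =
      sliceOp q N (.cup (x + 1) b) * sliceOp q N (.cross x (!o)) := by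
  refine pair_shift_congr q N (s := .cup 0 b) (t := .cross 1 o) (s' := .cup 1 b)
    (t' := .cross 0 (!o)) ?_ x
  ext f σ
  simp only [Module.End.mul_apply]
  match σ with
  | [] =>
    rw [sliceOp_cup_zero, sliceOp_of_length_lt _ (.cup 1 _)]
    · refine Finset.sum_eq_zero fun k _ => ?_
      rw [sliceOp_of_length_lt, mul_zero]
      simp [Slice.pos, Slice.arity]
    · simp [Slice.pos, Slice.arity]
  | (a, i) :: r =>
    rw [sliceOp_cup_zero]
    change _ = sliceOp q N ((Slice.cup 0 b).shift 1) _ _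
    rw [sliceOp_shift_one, sliceOp_cup_zero]
    have e : ∀ m : Fin N, sliceOp q N (.cross 1 o) f ((b, m) :: (!b, m) :: (a, i) :: r) =
        ∑ k, ∑ l, crossWeight q o (!b) a m i k l * f ((b, m) :: (a, k) :: (!b, l) :: r) :=
      fun m => by
        change sliceOp q N ((Slice.cross 0 o).shift 1) f _ = _
        rw [sliceOp_shift_one, sliceOp_cross_zero]
    simp only [e, sliceOp_cross_zero, Finset.mul_sum, ← mul_assoc]
    simp only [crossWeight_rotate_cup q hq]
    have sw : ∀ G : Fin N → Fin N → Fin N → F,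
        ∑ m, ∑ k, ∑ l, G m k l = ∑ l, ∑ m, ∑ k, G m k l := fun G =>
      (Finset.sum_congr rfl fun m _ => Finset.sum_comm).trans Finset.sum_comm
    rw [sw]

/-- The second Reidemeister move. It is stated pointwise because on lists with too few strands the
left side is 0 while `f σ` need not be. -/
theorem cross_mul_cross_apply (x : ℕ) (o : Bool) (f : List (Bool × Fin N) → F)
    (σ : List (Bool × Fin N)) (h : x + 2 ≤ σ.length) :
    sliceOp q N (.cross x o) (sliceOp q N (.cross x (!o)) f) σ = f σ := by
  obtain ⟨u, v, rfl, rfl⟩ := exists_append_of_le_length (show x ≤ σ.length by omega)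
  match v with
  | [] | [_] => simp at h
  | (a, i) :: (b, j) :: r =>
    have := diagramOp_shift q [.cross 0 o, .cross 0 (!o)] f u ((a, i) :: (b, j) :: r)
    simp only [diagramOp, List.map_cons, List.map_nil, List.prod_cons, List.prod_nil, mul_one,
      Module.End.mul_apply, Slice.shift, add_zero] at this
    rw [this]
    simp only [sliceOp_cross_zero, Finset.mul_sum, ← mul_assoc]
    have e : ∀ m n : Fin N, ∑ k, ∑ l, crossWeight q o a b i j k l *
        crossWeight q (!o) b a k l m n * f (u ++ (a, m) :: (b, n) :: r) =
        if m = i ∧ n = j then f (u ++ (a, m) :: (b, n) :: r) else 0 := fun m n => by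
      simp only [← Finset.sum_mul, sum_crossWeight_mul_crossWeight q hq]
      split_ifs <;> simp
    have sw : ∀ G : Fin N → Fin N → Fin N → Fin N → F,
        ∑ k, ∑ l, ∑ m, ∑ n, G k l m n = ∑ m, ∑ n, ∑ k, ∑ l, G k l m n := fun G => by
      simpa only [Fintype.sum_prod_type] using Finset.sum_comm
        (s := Finset.univ (α := Fin N × Fin N)) (t := Finset.univ (α := Fin N × Fin N))
        (f := fun x y => G x.1 x.2 y.1 y.2)
    calc _ = ∑ m, ∑ n, ∑ k, ∑ l, crossWeight q o a b i j k l *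
        crossWeight q (!o) b a k l m n * f (u ++ (a, m) :: (b, n) :: r) := by
          exact sw _
      _ = _ := by
        simp only [e, ite_and]
        simp

/-- The first Reidemeister move at a cap of anti-parallel strands. -/
theorem cross_mul_cap_self (x : ℕ) (o : Bool) :
    sliceOp q N (.cross x o) * sliceOp q N (.cap x) =
      (if o then (q ^ N)⁻¹ else q ^ N) • sliceOp q N (.cap x) := by
  have := diagramOp_shift_smul_congr q (N := N) (d := [.cross 0 o, .cap 0]) (d' := [.cap 0])
    (List.cons_ne_nil _ _) (List.cons_ne_nil _ _) (if o then (q ^ N)⁻¹ else q ^ N) ?_ x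
  · simpa [diagramOp, Slice.shift] using this
  · simp only [diagramOp, List.map_cons, List.map_nil, List.prod_cons, List.prod_nil, mul_one]
    ext f σ
    simp only [Module.End.mul_apply, LinearMap.smul_apply, Pi.smul_apply, smul_eq_mul]
    match σ with
    | [] | [_] =>
      rw [sliceOp_of_length_lt, sliceOp_of_length_lt, mul_zero] <;> simp [Slice.pos, Slice.arity]
    | (a, i) :: (b, j) :: r =>
      rw [sliceOp_cross_zero, sliceOp_cap_zero]
      simp only [sliceOp_cap_zero]
      by_cases hac : a = b
      · simp [hac]
      · obtain rfl : b = !a := by cases a <;> cases b <;> simp_all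
        have := sum_crossWeight_mul_capWeight q hq (N := N) o a i j
        simp only [ne_eq, Bool.eq_not_self, Bool.not_eq_self, not_false_eq_true, true_and, ite_mul,
          zero_mul, mul_ite, mul_zero, Finset.sum_ite_eq, Finset.mem_univ,
          if_true, ← mul_assoc, ← Finset.sum_mul]
        rw [this]
        split_ifs <;> simp

/-- The skein relation for anti-parallel strands. -/
theorem sliceOp_skein (f : List (Bool × Fin N) → F) (a : Bool) (i j : Fin N)
    (u v : List (Bool × Fin N)) :
    sliceOp q N (.cross u.length false) f (u ++ (a, i) :: (!a, j) :: v) =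
      sliceOp q N (.cross u.length true) f (u ++ (a, i) :: (!a, j) :: v) +
        (q - q⁻¹) * sliceOp q N (.cap u.length) (sliceOp q N (.cup u.length (!a)) f)
          (u ++ (a, i) :: (!a, j) :: v) := by
  have h1 : ∀ o, sliceOp q N (.cross u.length o) f (u ++ (a, i) :: (!a, j) :: v) = _ :=
    fun o => sliceOp_shift q (.cross 0 o) f u _
  have h2 := diagramOp_shift q [.cap 0, .cup 0 (!a)] f u ((a, i) :: (!a, j) :: v)
  simp only [diagramOp, List.map_cons, List.map_nil, List.prod_cons, List.prod_nil, mul_one,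
      Module.End.mul_apply, Slice.shift, add_zero] at h2
  rw [h1, h1, h2]
  simp only [sliceOp_cross_zero, sliceOp_cap_zero, sliceOp_cup_zero, crossWeight_skein q hq,
    add_mul, Finset.sum_add_distrib, mul_assoc, ← Finset.mul_sum, Bool.not_not]
  simp

omit hq in
-- A small circle is worth D. The length bound is needed because a cup outside the list gives 0.
theorem cup_mul_cap_self (hq : q ≠ 0) (hq' : q - q⁻¹ ≠ 0) (x : ℕ) (b : Bool)
    (f : List (Bool × Fin N) → F) (σ : List (Bool × Fin N)) (h : x ≤ σ.length) :
    sliceOp q N (.cup x b) (sliceOp q N (.cap x) f) σ = dimAt q N * f σ := by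
  obtain ⟨u, v, rfl, rfl⟩ := exists_append_of_le_length h
  have := diagramOp_shift q [.cup 0 b, .cap 0] f u v
  simp only [diagramOp, List.map_cons, List.map_nil, List.prod_cons, List.prod_nil, mul_one,
      Module.End.mul_apply, Slice.shift, add_zero] at this
  rw [this]
  simp only [sliceOp_cup_zero, sliceOp_cap_zero]
  simp [← mul_assoc, ← Finset.sum_mul, sum_cupWeight_mul_capWeight q hq hq']

omit hq in
/-- A cup and a cap form a straight strand. -/
theorem cup_mul_cap_right (hq : q ≠ 0) (u v : List (Bool × Fin N)) (s : Bool × Fin N)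
    (f : List (Bool × Fin N) → F) :
    sliceOp q N (.cup (u.length + 1) (!s.1)) (sliceOp q N (.cap u.length) f) (u ++ s :: v) =
      f (u ++ s :: v) := by
  have := diagramOp_shift q [.cup 1 (!s.1), .cap 0] f u (s :: v)
  simp only [diagramOp, List.map_cons, List.map_nil, List.prod_cons, List.prod_nil, mul_one,
      Module.End.mul_apply, Slice.shift, add_zero] at this
  rw [this]
  change sliceOp q N ((Slice.cup 0 (!s.1)).shift 1) _ _ = _
  rw [sliceOp_shift_one, sliceOp_cup_zero]
  simp only [sliceOp_cap_zero]
  obtain ⟨a, i⟩ := s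
  have hw := colourWeight_ne_zero q hq i
  cases a
  · simp [cupWeight, capWeight]
  · simp [cupWeight, capWeight, inv_mul_cancel_left₀ hw]

end Moves

end LinkDiagram

/-! ### Releasing a hook -/

namespace LinkDiagram

section Hooks

variable {F : Type*} [Field F] {q : F} (N : ℕ)

theorem sliceOp_cup_congr (x : ℕ) (b : Bool) {f g : List (Bool × Fin N) → F}
    (σ : List (Bool × Fin N))
    (h : ∀ τ : List (Bool × Fin N), x + 2 ≤ τ.length → τ.length = σ.length + 2 → f τ = g τ) :
    sliceOp q N (.cup x b) f σ = sliceOp q N (.cup x b) g σ := by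
  rw [sliceOp_apply, sliceOp_apply]
  simp only [sliceFun]
  split_ifs with hx
  · refine Finset.sum_congr rfl fun i _ => ?_
    rw [h] <;> simp <;> omega
  · rfl

theorem cap_mul_cap (x : ℕ) :
    sliceOp q N (.cap x) * sliceOp q N (.cap x) =
      sliceOp q N (.cap (x + 2)) * sliceOp q N (.cap x) := by
  rw [← shift_mul_cap q N x (.cap x) le_rfl, Slice.shift, add_comm]

theorem cup_mul_cap_two (x : ℕ) (b : Bool) :
    sliceOp q N (.cup x b) * sliceOp q N (.cap (x + 2)) =
      sliceOp q N (.cap x) * sliceOp q N (.cup x b) := by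
  rw [← cup_mul_shift q N x b (.cap x) le_rfl, Slice.shift, add_comm]

theorem cup_two_mul_cap (x y : ℕ) (b : Bool) (h : x ≤ y) :
    sliceOp q N (.cup (y + 2) b) * sliceOp q N (.cap x) =
      sliceOp q N (.cap x) * sliceOp q N (.cup y b) := by
  rw [← shift_mul_cap q N x (.cup y b) h, Slice.shift, add_comm]

theorem cup_mul_cup (x : ℕ) (b c : Bool) :
    sliceOp q N (.cup x b) * sliceOp q N (.cup x c) =
      sliceOp q N (.cup x c) * sliceOp q N (.cup (x + 2) b) := by
  rw [← cup_mul_shift q N x c (.cup x b) le_rfl, Slice.shift, add_comm]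

variable (hq : q ≠ 0)
include hq

/-- A strand is pulled off a maximum: one crossing slides around the cap and then cancels the other.
-/
theorem cross_mul_cross_mul_cap_left (x : ℕ) (o : Bool) :
    sliceOp q N (.cross x o) * (sliceOp q N (.cross (x + 1) o) * sliceOp q N (.cap x)) =
      sliceOp q N (.cap (x + 1)) := by
  have := cross_mul_cap N hq x (!o)
  rw [Bool.not_not] at this
  rw [← this]
  ext f σ
  simp only [Module.End.mul_apply]
  rcases Nat.lt_or_ge σ.length (x + 2) with h | h
  · rw [sliceOp_of_length_lt, sliceOp_of_length_lt] <;> simp only [Slice.pos, Slice.arity] <;> omega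
  · exact cross_mul_cross_apply N hq x o _ σ h

/-- Without the second cap this fails on lists of length x + 2, where `cap x` alone need not vanish.
With `x ≤ y + 1` the second cap finds too few strands there, so both sides are 0. -/
theorem cross_mul_cross_mul_cap_right (x y : ℕ) (hxy : x ≤ y + 1) (o : Bool) :
    sliceOp q N (.cross (x + 1) o) * (sliceOp q N (.cross x o) *
      (sliceOp q N (.cap (x + 1)) * sliceOp q N (.cap y))) =
      sliceOp q N (.cap x) * sliceOp q N (.cap y) := by
  rw [← mul_assoc (sliceOp q N (.cross x o)), cross_mul_cap N hq x o]
  ext f σ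
  simp only [Module.End.mul_apply]
  rcases Nat.lt_or_ge σ.length (x + 3) with h | h
  · rw [sliceOp_of_length_lt]
    · rcases Nat.lt_or_ge σ.length (x + 2) with h' | h'
      · rw [sliceOp_of_length_lt]; simp only [Slice.pos, Slice.arity]; omega
      · obtain ⟨u, v, rfl, rfl⟩ := exists_append_of_le_length (show x ≤ σ.length by omega)
        match v with
        | [] | [_] => simp at h'
        | s :: t :: r =>
          have := sliceOp_shift q (.cap 0) (sliceOp q N (.cap y) f) u (s :: t :: r)
          rw [sliceOp_cap_zero, sliceOp_of_length_lt q (.cap y), mul_zero] at this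
          · exact this.symm
          · simp only [List.length_append, List.length_cons, Slice.pos, Slice.arity] at h ⊢; omega
    · simp only [Slice.pos, Slice.arity]; omega
  · exact cross_mul_cross_apply N hq (x + 1) o _ σ h

theorem cup_mul_cross_mul_cross_right (x : ℕ) (b o : Bool) :
    sliceOp q N (.cup x b) * (sliceOp q N (.cross (x + 1) o) * sliceOp q N (.cross x o)) =
      sliceOp q N (.cup (x + 1) b) := by
  rw [← mul_assoc, cup_mul_cross N hq, mul_assoc]
  ext f σ
  simp only [Module.End.mul_apply]
  refine sliceOp_cup_congr N _ _ σ fun τ h _ => ?_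
  have := cross_mul_cross_apply N hq x (!o) f τ (by omega)
  rwa [Bool.not_not] at this

/-- The lower cup only guarantees that enough strands are present for the second Reidemeister move.
-/
theorem cup_mul_cross_mul_cross_left (x y : ℕ) (hxy : x ≤ y + 1) (b c o : Bool) :
    sliceOp q N (.cup y c) * (sliceOp q N (.cup (x + 1) b) *
      (sliceOp q N (.cross x o) * sliceOp q N (.cross (x + 1) o))) =
      sliceOp q N (.cup y c) * sliceOp q N (.cup x b) := by
  have := cup_mul_cross N hq x b (!o)
  rw [Bool.not_not] at this
  rw [← mul_assoc (sliceOp q N (.cup (x + 1) b)), ← this, mul_assoc]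
  ext f σ
  simp only [Module.End.mul_apply]
  refine sliceOp_cup_congr N _ _ σ fun τ h _ => sliceOp_cup_congr N _ _ τ fun ρ h' h'' => ?_
  have := cross_mul_cross_apply N hq (x + 1) (!o) f ρ (by omega)
  rwa [Bool.not_not] at this

/-- A band that is closed after it has been hooked releases the hooking band. -/
theorem hookFromRight_mul_cap (x : ℕ) (o : Bool) :
    diagramOp q N (hookFromRight x o) * sliceOp q N (.cap x) =
      sliceOp q N (.cap x) * sliceOp q N (.cap x) := by
  simp only [hookFromRight, diagramOp_cons, diagramOp_nil, mul_one, mul_assoc, cap_mul_cap]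
  rw [cross_mul_cross_mul_cap_right N hq (x + 1) x le_rfl,
    cross_mul_cross_mul_cap_right N hq x x (by omega), cap_mul_cap]

/-- A band that begins just below the place where it is hooked releases the hooking band. -/
theorem cup_mul_hookFromRight (x : ℕ) (b o : Bool) :
    sliceOp q N (.cup x b) * diagramOp q N (hookFromRight x o) =
      sliceOp q N (.cap x) * sliceOp q N (.cup x b) := by
  have h1 := cup_mul_cross_mul_cross_right N hq x b (!o)
  have h2 := cup_mul_cross_mul_cross_right N hq (x + 1) b o
  simp only [← mul_assoc] at h1 h2
  simp only [hookFromRight, diagramOp_cons, diagramOp_nil, mul_one, ← mul_assoc]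
  rw [h1, h2, cup_two_mul_cap N x x b le_rfl]

theorem hookTip_mul_cap (x : ℕ) (b o : Bool) :
    diagramOp q N (hookTip x b o) * sliceOp q N (.cap x) =
      sliceOp q N (.cap x) * sliceOp q N (.cup x b) := by
  simp only [hookTip, diagramOp_cons, diagramOp_nil, mul_one, mul_assoc]
  rw [cross_mul_cross_mul_cap_left N hq, cross_mul_cross_mul_cap_left N hq, cup_mul_cap_two]

/-- If the hooked band starts at a minimum just below, that minimum can be pulled out of the finger,
whichever edge lies over. -/
theorem cup_mul_hookTip (x : ℕ) (b c o : Bool) :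
    sliceOp q N (.cup x c) * diagramOp q N (hookTip x b o) =
      sliceOp q N (.cup x b) * sliceOp q N (.cup x c) := by
  have h1 := cup_mul_cross_mul_cross_left N hq (x + 1) x le_rfl c b o
  have h2 := cup_mul_cross_mul_cross_left N hq x x (by omega) c b (!o)
  simp only [← mul_assoc] at h1 h2
  simp only [hookTip, diagramOp_cons, diagramOp_nil, mul_one, ← mul_assoc]
  rw [cup_mul_cup, h1, h2]

end Hooks

end LinkDiagram

/-! ### Cutting a band -/

namespace LinkDiagram

/-- The part of the diagram of `kanenobu` above the first `j` hooks. -/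
def hookChain (o : ℕ → Bool) : ℕ → List Slice
  | 0 => [.cap 1, .cap 0]
  | j + 1 => hookFromRight (2 * j) (o j) ++ hookChain o j

/-- The orientations of the strands above a slice. -/
def orientStep : Slice → List Bool → List Bool
  | .cup x b, ω => ω.take x ++ b :: (!b) :: ω.drop x
  | .cap x, ω => ω.take x ++ ω.drop (x + 2)
  | .cross x _, ω =>
      match ω.drop x with
      | a :: b :: r => ω.take x ++ b :: a :: r
      | _ => ω

/-- The orientations of the strands above a diagram. -/
def orientAbove (d : List Slice) (ω : List Bool) : List Bool :=
  d.foldl (fun ω s => orientStep s ω) ω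

theorem orientAbove_append (d e : List Slice) (ω : List Bool) :
    orientAbove (d ++ e) ω = orientAbove e (orientAbove d ω) := by
  simp [orientAbove]

theorem orientStep_shift (s : Slice) (u v : List Bool) :
    orientStep (s.shift u.length) (u ++ v) = u ++ orientStep s v := by
  have ht : ∀ x, (u ++ v).take (u.length + x) = u ++ v.take x := fun x => by
    simp [List.take_append, List.take_of_length_le]
  have hd : ∀ x, (u ++ v).drop (u.length + x) = v.drop x := fun x => by
    simp [List.drop_append]
  cases s with
  | cup x b => simp [Slice.shift, orientStep, ht, hd]
  | cap x => simp [Slice.shift, orientStep, ht, hd, add_assoc]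
  | cross x o =>
    simp only [Slice.shift, orientStep, ht, hd]
    split <;> simp

theorem orientAbove_shift (d : List Slice) (u v : List Bool) :
    orientAbove (d.map (Slice.shift u.length)) (u ++ v) = u ++ orientAbove d v := by
  induction d generalizing v with
  | nil => rfl
  | cons s d ih =>
    simp only [orientAbove, List.map_cons, List.foldl_cons] at ih ⊢
    rw [orientStep_shift, ih]

theorem hookFromRight_eq_map_shift (x : ℕ) (o : Bool) :
    hookFromRight x o = (hookFromRight 0 o).map (Slice.shift x) := rfl

theorem hookTip_eq_map_shift (x : ℕ) (b o : Bool) :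
    hookTip x b o = (hookTip 0 b o).map (Slice.shift x) := rfl

theorem orientAbove_hookFromRight (o : Bool) (u v : List Bool) (a b c d : Bool) :
    orientAbove (hookFromRight u.length o) (u ++ a :: b :: c :: d :: v) = u ++ a :: b :: v := by
  rw [hookFromRight_eq_map_shift, orientAbove_shift]
  rfl

section Cut

variable {F : Type*} [Field F] {q : F} {N : ℕ}

/-- Slices sum over colours but determine orientations, so functions need to agree only on strands
with the expected orientations. This allows moves that hold only for anti-parallel strands to be
used inside a diagram. -/
theorem sliceOp_congr (s : Slice) {f g : List (Bool × Fin N) → F} (σ : List (Bool × Fin N))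
    (h : ∀ τ : List (Bool × Fin N),
      τ.map Prod.fst = orientStep s (σ.map Prod.fst) → f τ = g τ) :
    sliceOp q N s f σ = sliceOp q N s g σ := by
  rw [sliceOp_apply, sliceOp_apply]
  cases s with
  | cup x b =>
    simp only [sliceFun]
    split_ifs
    · refine Finset.sum_congr rfl fun i _ => ?_
      rw [h]; simp [orientStep, List.map_take, List.map_drop]
    · rfl
  | cap x =>
    simp only [sliceFun]
    split
    · rename_i a i b j r heq
      split_ifs
      · rw [h]
        have : σ.drop (x + 2) = r := by rw [← List.drop_drop, heq]; rfl
        simp [orientStep, ← List.map_take, ← List.map_drop, this]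
      · rfl
    · rfl
  | cross x o =>
    simp only [sliceFun]
    split
    · rename_i a i b j r heq
      refine Finset.sum_congr rfl fun k _ => Finset.sum_congr rfl fun l _ => ?_
      rw [h]
      simp [orientStep, ← List.map_take, ← List.map_drop, heq]
    · rfl

theorem diagramOp_congr (d : List Slice) {f g : List (Bool × Fin N) → F}
    (σ : List (Bool × Fin N))
    (h : ∀ τ : List (Bool × Fin N),
      τ.map Prod.fst = orientAbove d (σ.map Prod.fst) → f τ = g τ) :
    diagramOp q N d f σ = diagramOp q N d g σ := by
  induction d generalizing σ with
  | nil => exact h σ rfl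
  | cons s d ih =>
    simp only [diagramOp_cons, Module.End.mul_apply]
    refine sliceOp_congr s σ fun τ hτ => ih τ fun ρ hρ => h ρ ?_
    rw [hρ, hτ]; rfl

variable (q N) in
-- Repeated caps at `x` close consecutive pairs of strands; the pair number `k` may equally well be
-- closed first.
theorem cap_mul_cap_pow (x k m : ℕ) (h : k ≤ m) :
    sliceOp q N (.cap (x + 2 * k)) * sliceOp q N (.cap x) ^ m = sliceOp q N (.cap x) ^ (m + 1) := by
  induction k generalizing m with
  | zero => rw [pow_succ']; rfl
  | succ k ih =>
    obtain ⟨m, rfl⟩ : ∃ m', m = m' + 1 := ⟨m - 1, by omega⟩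
    have := shift_mul_cap q N x (.cap (x + 2 * k)) (by simp [Slice.pos])
    rw [pow_succ', ← mul_assoc]
    rw [Slice.shift, show 2 + (x + 2 * k) = x + 2 * (k + 1) by ring] at this
    rw [this, mul_assoc, ih m (by omega), ← pow_succ']

variable (q N) in
theorem cap_pow_mul_cap_pow (k m : ℕ) :
    sliceOp q N (.cap (2 * k)) ^ m * sliceOp q N (.cap 0) ^ k = sliceOp q N (.cap 0) ^ (m + k) := by
  induction m with
  | zero => simp
  | succ m ih =>
    rw [pow_succ', mul_assoc, ih]
    have := cap_mul_cap_pow q N 0 k (m + k) (by omega)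
    rw [zero_add] at this
    rw [this]; congr 1; ring

variable (q N) in
theorem cup_mul_cap_pow (x k : ℕ) (b : Bool) :
    sliceOp q N (.cup (x + 2 * k) b) * sliceOp q N (.cap x) ^ k =
      sliceOp q N (.cap x) ^ k * sliceOp q N (.cup x b) := by
  induction k with
  | zero => simp
  | succ k ih =>
    rw [pow_succ', ← mul_assoc, show x + 2 * (k + 1) = x + 2 * k + 2 by ring,
      cup_two_mul_cap N x (x + 2 * k) b (by omega), mul_assoc, ih, mul_assoc]

variable (q N) in
theorem cup_mul_hookFromRight_far (x : ℕ) (b o : Bool) :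
    sliceOp q N (.cup (x + 4) b) * diagramOp q N (hookFromRight x o) =
      diagramOp q N (hookFromRight x o) * sliceOp q N (.cup (x + 2) b) := by
  have h : ∀ y o, y ≤ x + 2 → sliceOp q N (.cup (x + 4) b) * sliceOp q N (.cross y o) =
      sliceOp q N (.cross y o) * sliceOp q N (.cup (x + 4) b) := fun y o hy => by
    have := cross_mul_shift q N y o (.cup (x + 2) b) hy
    rw [Slice.shift, show 2 + (x + 2) = x + 4 by ring] at this
    exact this.symm
  have h' : ∀ y o z, y ≤ x + 2 →
      sliceOp q N (.cup (x + 4) b) * (sliceOp q N (.cross y o) * z) =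
      sliceOp q N (.cross y o) * (sliceOp q N (.cup (x + 4) b) * z) := fun y o z hy => by
    rw [← mul_assoc, h y o hy, mul_assoc]
  simp only [hookFromRight, diagramOp_cons, diagramOp_nil, mul_one, mul_assoc]
  rw [h' _ _ _ (by omega), h' _ _ _ (by omega), h' _ _ _ (by omega), h' _ _ _ (by omega),
    cup_two_mul_cap N x (x + 2) b (by omega)]

/-- The caps consume all of `v`, so only the value at `u` is ever used. -/
theorem cap_pow_congr {f g : List (Bool × Fin N) → F} (m : ℕ) (u v : List (Bool × Fin N))
    (hv : v.length = 2 * m) (h : f u = g u) :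
    (sliceOp q N (.cap u.length) ^ m) f (u ++ v) =
      (sliceOp q N (.cap u.length) ^ m) g (u ++ v) := by
  induction m generalizing v with
  | zero =>
    obtain rfl : v = [] := List.length_eq_zero_iff.mp (by omega)
    simpa using h
  | succ m ih =>
    match v with
    | [] | [_] => simp at hv; try omega
    | s :: t :: r =>
      have hr := ih r (by simp at hv; omega)
      have e : ∀ f, sliceOp q N (.cap u.length) f (u ++ s :: t :: r) = _ := fun f =>
        sliceOp_shift q (.cap 0) f u (s :: t :: r)
      rw [pow_succ', Module.End.mul_apply, Module.End.mul_apply, e, e, sliceOp_cap_zero,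
        sliceOp_cap_zero, hr]

variable (hq : q ≠ 0)
include hq

/-- If the finger at the top does not hook any band, then all bands are released. -/
theorem cup_mul_hookChain (o : ℕ → Bool) (b : Bool) (j : ℕ) (f : List (Bool × Fin N) → F)
    (σ : List (Bool × Fin N)) (ω : List Bool) (hσ : σ.map Prod.fst = b :: (!b) :: ω)
    (hl : σ.length = 2 * j + 2) :
    sliceOp q N (.cup (2 * j + 2) b) (diagramOp q N (hookChain o j) f) σ =
      (sliceOp q N (.cap 0) ^ (j + 1)) f σ := by
  induction j generalizing σ ω with
  | zero =>
    match σ, hl with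
    | [s, t], _ =>
      simp only [List.map_cons, List.cons.injEq] at hσ
      have := cup_mul_cap_right N hq [s] [] t (sliceOp q N (.cap 0) f)
      rw [hσ.2.1, Bool.not_not] at this
      simpa [hookChain, diagramOp] using this
  | succ j ih =>
    have far := cup_mul_hookFromRight_far q N (2 * j) b (o j)
    rw [hookChain, diagramOp_append, Module.End.mul_apply, ← Module.End.mul_apply,
      show 2 * (j + 1) + 2 = 2 * j + 4 by ring, far, Module.End.mul_apply]
    obtain ⟨u, v, rfl, hu⟩ := exists_append_of_le_length (show 2 * j ≤ σ.length by omega)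
    have hv : v.length = 4 := by simp at hl; omega
    match v, hv with
    | [s1, s2, s3, s4], _ =>
      -- By induction the bands below the last hook are already closed by caps; in particular the
      -- hooked band is, so it releases the hooking one.
      rw [diagramOp_congr (g := (sliceOp q N (.cap 0) ^ (j + 1)) f)]
      · have h1 := cap_mul_cap_pow q N 0 j j le_rfl
        have h2 := cap_mul_cap_pow q N 0 j (j + 1) (by omega)
        rw [zero_add] at h1 h2
        rw [← h1, ← Module.End.mul_apply, ← mul_assoc, hookFromRight_mul_cap N hq, mul_assoc, h1,
          h2]
      · intro τ hτ
        have hu' : (u.map Prod.fst).length = 2 * j := by simpa using hu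
        have := orientAbove_hookFromRight (o j) (u.map Prod.fst) [] s1.1 s2.1 s3.1 s4.1
        rw [hu'] at this
        simp only [List.map_append, List.map_cons, List.map_nil] at hτ hσ
        rw [this] at hτ
        have hl' : τ.length = 2 * j + 2 := by
          have := congrArg List.length hτ
          simpa [hu] using this
        cases u with
        | nil =>
          simp only [List.map_nil, List.nil_append, List.cons.injEq] at hσ hτ
          exact ih τ [] (by rw [hτ, hσ.1, hσ.2.1]) hl'
        | cons s u =>
          cases u with
          | nil => simp at hu; omega
          | cons t u =>
            simp only [List.map_cons, List.cons_append, List.cons.injEq] at hσ hτ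
            exact ih τ (u.map Prod.fst ++ [s1.1, s2.1]) (by rw [hτ, hσ.1, hσ.2.1]) hl'

omit hq in
theorem le_pos_of_mem_hookFromRight {x y : ℕ} {o : Bool} (h : x ≤ y) :
    ∀ s ∈ hookFromRight y o, x ≤ s.pos := by
  simp only [hookFromRight, List.mem_cons, List.not_mem_nil, or_false]
  rintro s (rfl | rfl | rfl | rfl | rfl) <;> simp only [Slice.pos] <;> omega

omit hq in
theorem le_pos_of_mem_hookTip {x y : ℕ} {b o : Bool} (h : x ≤ y) :
    ∀ s ∈ hookTip y b o, x ≤ s.pos := by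
  simp only [hookTip, List.mem_cons, List.not_mem_nil, or_false]
  rintro s (rfl | rfl | rfl | rfl | rfl) <;> simp only [Slice.pos] <;> omega

theorem hookFromRight_mul_cap_pow (x k : ℕ) (o : Bool) :
    diagramOp q N (hookFromRight (x + 2 * k) o) * sliceOp q N (.cap x) ^ (k + 1) =
      sliceOp q N (.cap x) ^ (k + 2) := by
  rw [← cap_mul_cap_pow q N x k k le_rfl, ← mul_assoc, hookFromRight_mul_cap N hq, mul_assoc,
    cap_mul_cap_pow q N x k k le_rfl, cap_mul_cap_pow q N x k (k + 1) (by omega)]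

theorem hookTip_mul_cap_pow (x k : ℕ) (b o : Bool) :
    diagramOp q N (hookTip (x + 2 * k) b o) * sliceOp q N (.cap x) ^ (k + 1) =
      sliceOp q N (.cap x) ^ (k + 1) * sliceOp q N (.cup x b) := by
  rw [← cap_mul_cap_pow q N x k k le_rfl, ← mul_assoc, hookTip_mul_cap N hq, mul_assoc,
    cup_mul_cap_pow, mul_assoc]

/-- A fresh start of band i releases band i + 1, whose free end releases the next, and so on: `k +
1` bands are closed and only the hooks below band i survive. -/
theorem cup_mul_hookChain_add (o : ℕ → Bool) (b : Bool) (i k : ℕ) :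
    sliceOp q N (.cup (2 * i) b) * diagramOp q N (hookChain o (i + 1 + k)) =
      sliceOp q N (.cap (2 * i)) ^ (k + 1) *
        (sliceOp q N (.cup (2 * i) b) * diagramOp q N (hookChain o i)) := by
  induction k with
  | zero =>
    rw [add_zero, hookChain, diagramOp_append, ← mul_assoc, cup_mul_hookFromRight N hq, zero_add,
      pow_one, mul_assoc]
  | succ k ih =>
    rw [← add_assoc, hookChain, diagramOp_append, ← mul_assoc,
      show 2 * (i + 1 + k) = 2 + (2 * i + 2 * k) by ring, hookFromRight_eq_map_shift,
      show Slice.shift (2 + (2 * i + 2 * k)) =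
        Slice.shift 2 ∘ Slice.shift (2 * i + 2 * k) from funext fun s => (shift_shift _ _ s).symm,
      ← List.map_map, ← hookFromRight_eq_map_shift, cup_mul_map_shift, mul_assoc, ih, ← mul_assoc,
      hookFromRight_mul_cap_pow hq]
    exact le_pos_of_mem_hookFromRight (by omega)

theorem cup_mul_hookTip_mul_hookChain (o : ℕ → Bool) (b c e : Bool) (i k : ℕ) :
    sliceOp q N (.cup (2 * i) b) *
        diagramOp q N (hookTip (2 * (i + k)) c e ++ hookChain o (i + k)) =
      sliceOp q N (.cap (2 * i)) ^ k * (sliceOp q N (.cup (2 * i) b) *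
        (sliceOp q N (.cup (2 * i + 2) c) * diagramOp q N (hookChain o i))) := by
  rw [diagramOp_append]
  -- For k = 0 the finger of band 0 hooks the cut band itself; otherwise it hooks a band that the
  -- chain reaction has already closed.
  cases k with
  | zero =>
    rw [add_zero, ← mul_assoc, cup_mul_hookTip N hq, cup_mul_cup, pow_zero, one_mul, mul_assoc]
  | succ k =>
    rw [← mul_assoc, show 2 * (i + (k + 1)) = 2 + (2 * i + 2 * k) by ring, hookTip_eq_map_shift,
      show Slice.shift (2 + (2 * i + 2 * k)) =
        Slice.shift 2 ∘ Slice.shift (2 * i + 2 * k) from funext fun s => (shift_shift _ _ s).symm,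
      ← List.map_map, ← hookTip_eq_map_shift, cup_mul_map_shift, mul_assoc,
      show i + (k + 1) = i + 1 + k by ring, cup_mul_hookChain_add hq, ← mul_assoc,
      hookTip_mul_cap_pow hq, mul_assoc, ← mul_assoc (sliceOp q N (.cup _ c)), cup_mul_cup,
      mul_assoc (sliceOp q N (.cup _ b))]
    exact le_pos_of_mem_hookTip (by omega)

/-- The value of the diagram above the boxes if the band `i` is cut. -/
theorem cap_cup_hookTip_hookChain (hq' : q - q⁻¹ ≠ 0) (o : ℕ → Bool) (b c e : Bool) (i k : ℕ)
    (f : List (Bool × Fin N) → F) (u v : List (Bool × Fin N)) (hu : u.length = 2 * i)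
    (hv : v.length = 2 * (k + 1)) (ω : List Bool)
    (hω : u.map Prod.fst ++ [b, !b] = c :: (!c) :: ω) :
    sliceOp q N (.cap (2 * i)) (sliceOp q N (.cup (2 * i) b)
        (diagramOp q N (hookTip (2 * (i + k)) c e ++ hookChain o (i + k)) f)) (u ++ v) =
      dimAt q N * (sliceOp q N (.cap 0) ^ (i + k + 1)) f (u ++ v) := by
  rw [← Module.End.mul_apply (sliceOp q N (.cup (2 * i) b)), cup_mul_hookTip_mul_hookChain hq,
    ← Module.End.mul_apply, ← mul_assoc, ← pow_succ', Module.End.mul_apply, ← hu]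
  rw [cap_pow_congr (g := dimAt q N • (sliceOp q N (.cap 0) ^ i) f) (k + 1) u v hv]
  · have := cap_pow_mul_cap_pow q N i (k + 1)
    rw [map_smul, Pi.smul_apply, hu, ← Module.End.mul_apply, this, smul_eq_mul,
      show k + 1 + i = i + k + 1 by ring]
  · rw [Module.End.mul_apply, Pi.smul_apply, smul_eq_mul,
      ← cup_mul_cap_self N hq hq' u.length b _ u le_rfl]
    refine sliceOp_congr _ u fun τ hτ => ?_
    have hl : τ.map Prod.fst = u.map Prod.fst ++ [b, !b] := by
      rw [hτ]; simp [orientStep, List.take_of_length_le, List.drop_of_length_le]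
    have h1 := cap_mul_cap_pow q N 0 i i le_rfl
    rw [zero_add] at h1
    rw [Module.End.mul_apply, hu, cup_mul_hookChain hq o c i f τ ω (hl.trans hω), ← h1,
      Module.End.mul_apply]
    have := congrArg List.length hl
    simpa [hu] using this

end Cut

end LinkDiagram

/-! ### The pieces of the diagram -/

namespace LinkDiagram

/-- The boxes of the bands `0, …, k - 1`. -/
def boxes (p : ℕ → ℤ) (k : ℕ) : List Slice :=
  (List.range k).flatMap fun i => twistBox (2 * i) (p i)

/-- The minima of the disc with `n + 1` bands. -/
def bandCups (n : ℕ) : List Slice :=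
  .cup 0 true :: (List.range n).map fun i => .cup (2 * i + 1) false

/-- The orientations of the strands of `k` bands. -/
def bandOrient (a : ℕ → Bool) (k : ℕ) : List Bool :=
  (List.range k).flatMap fun i => [a i, !a i]

theorem boxes_succ (p : ℕ → ℤ) (k : ℕ) :
    boxes p (k + 1) = boxes p k ++ twistBox (2 * k) (p k) := by
  simp [boxes, List.range_succ]

theorem bandCups_succ (n : ℕ) : bandCups (n + 1) = bandCups n ++ [.cup (2 * n + 1) false] := by
  simp [bandCups, List.range_succ]

theorem bandOrient_succ (a : ℕ → Bool) (k : ℕ) :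
    bandOrient a (k + 1) = bandOrient a k ++ [a k, !a k] := by
  simp [bandOrient, List.range_succ]

theorem length_bandOrient (a : ℕ → Bool) (k : ℕ) : (bandOrient a k).length = 2 * k := by
  induction k with
  | zero => rfl
  | succ k ih => rw [bandOrient_succ, List.length_append, ih]; simp; ring

theorem bandOrient_succ_eq_cons (a : ℕ → Bool) (k : ℕ) :
    ∃ ω, bandOrient a (k + 1) = a 0 :: (!a 0) :: ω := by
  induction k with
  | zero => exact ⟨[], rfl⟩
  | succ k ih =>
    obtain ⟨ω, h⟩ := ih
    exact ⟨ω ++ [a (k + 1), !a (k + 1)], by rw [bandOrient_succ, h]; rfl⟩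

theorem bandOrient_add (a : ℕ → Bool) (i k : ℕ) :
    ∃ v, bandOrient a (i + k) = bandOrient a i ++ v ∧ v.length = 2 * k := by
  induction k with
  | zero => exact ⟨[], by simp⟩
  | succ k ih =>
    obtain ⟨v, h, hv⟩ := ih
    refine ⟨v ++ [a (i + k), !a (i + k)], ?_, by simp [hv]; ring⟩
    rw [← add_assoc, bandOrient_succ, h, List.append_assoc]

/-! ### The writhe -/

/-- The diagram `d` leads from strands with orientations `ω` to strands with orientations `ω'`, and
the signs of its crossings add up to `w`. -/
def HasWrithe (d : List Slice) (ω : List Bool) (w : ℤ) (ω' : List Bool) : Prop :=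
  orientAbove d ω = ω' ∧ ∀ e, writheFrom (d ++ e) ω = w + writheFrom e ω'

theorem HasWrithe.append {d e : List Slice} {ω ω' ω'' : List Bool} {w w' : ℤ}
    (h : HasWrithe d ω w ω') (h' : HasWrithe e ω' w' ω'') :
    HasWrithe (d ++ e) ω (w + w') ω'' :=
  ⟨by rw [orientAbove_append, h.1, h'.1], fun f => by rw [List.append_assoc, h.2, h'.2]; ring⟩

theorem HasWrithe.nil (ω : List Bool) : HasWrithe [] ω 0 ω := ⟨rfl, fun e => by simp⟩

theorem HasWrithe.cup (x : ℕ) (b : Bool) (ω : List Bool) :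
    HasWrithe [.cup x b] ω 0 (orientStep (.cup x b) ω) :=
  ⟨rfl, fun e => by simp [writheFrom, orientStep]⟩

theorem HasWrithe.cap (x : ℕ) (ω : List Bool) :
    HasWrithe [.cap x] ω 0 (orientStep (.cap x) ω) :=
  ⟨rfl, fun e => by simp [writheFrom, orientStep]⟩

/-- The sign of a crossing. -/
def crossingSign (o a b : Bool) : ℤ := if positiveCrossing o a b then 1 else -1

theorem HasWrithe.cross (u v : List Bool) (o a b : Bool) :
    HasWrithe [.cross u.length o] (u ++ a :: b :: v) (crossingSign o a b) (u ++ b :: a :: v) :=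
  ⟨by simp [orientAbove, orientStep], fun e => by simp [writheFrom, crossingSign]⟩

theorem HasWrithe.cross_succ (u v : List Bool) (o a b c : Bool) :
    HasWrithe [.cross (u.length + 1) o] (u ++ c :: a :: b :: v) (crossingSign o a b)
      (u ++ c :: b :: a :: v) := by
  simpa using HasWrithe.cross (u ++ [c]) v o a b

theorem HasWrithe.cross_succ_succ (u v : List Bool) (o a b c d : Bool) :
    HasWrithe [.cross (u.length + 2) o] (u ++ c :: d :: a :: b :: v) (crossingSign o a b)
      (u ++ c :: d :: b :: a :: v) := by
  simpa using HasWrithe.cross (u ++ [c, d]) v o a b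

/-- Each edge of the finger crosses two anti-parallel edges, over both or under both, so its two
crossings have opposite signs. -/
theorem hasWrithe_hookFromRight (u v : List Bool) (o a c : Bool) :
    HasWrithe (hookFromRight u.length o) (u ++ a :: (!a) :: c :: (!c) :: v) 0
      (u ++ a :: (!a) :: v) := by
  have h := ((((HasWrithe.cross_succ u ((!c) :: v) (!o) (!a) c a).append
    (HasWrithe.cross u ((!a) :: (!c) :: v) (!o) a c)).append
    (HasWrithe.cross_succ_succ u v o (!a) (!c) c a)).append
    (HasWrithe.cross_succ u ((!a) :: v) o a (!c) c)).append
    (HasWrithe.cap u.length (u ++ c :: (!c) :: a :: (!a) :: v))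
  have e : orientStep (.cap u.length) (u ++ c :: (!c) :: a :: (!a) :: v) = u ++ a :: (!a) :: v :=
    orientStep_shift (.cap 0) u _
  rw [e] at h
  have hw : crossingSign (!o) (!a) c + crossingSign (!o) a c + crossingSign o (!a) (!c) +
      crossingSign o a (!c) + 0 = 0 := by cases o <;> cases a <;> cases c <;> rfl
  rw [hw] at h
  exact h

theorem hasWrithe_hookTip (u v : List Bool) (b o a : Bool) :
    HasWrithe (hookTip u.length b o) (u ++ a :: (!a) :: v) 0
      (u ++ a :: (!a) :: b :: (!b) :: v) := by
  have h0 := HasWrithe.cup u.length b (u ++ a :: (!a) :: v)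
  have e : orientStep (.cup u.length b) (u ++ a :: (!a) :: v) =
      u ++ b :: (!b) :: a :: (!a) :: v := orientStep_shift (.cup 0 b) u _
  rw [e] at h0
  have h := (((h0.append (HasWrithe.cross_succ u ((!a) :: v) o (!b) a b)).append
    (HasWrithe.cross_succ_succ u v o (!b) (!a) b a)).append
    (HasWrithe.cross u ((!a) :: (!b) :: v) (!o) b a)).append
    (HasWrithe.cross_succ u ((!b) :: v) (!o) b (!a) a)
  have hw : 0 + crossingSign o (!b) a + crossingSign o (!b) (!a) + crossingSign (!o) b a +
      crossingSign (!o) b (!a) = 0 := by cases o <;> cases a <;> cases b <;> rfl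
  rw [hw] at h
  exact h

theorem hasWrithe_replicate_cross (u v : List Bool) (o a : Bool) (k : ℕ) :
    HasWrithe (List.replicate k (.cross u.length o)) (u ++ a :: (!a) :: v)
      (k * (if o then -1 else 1))
      (u ++ (a == decide (Even k)) :: (!(a == decide (Even k))) :: v) := by
  induction k with
  | zero => simpa using HasWrithe.nil _
  | succ k ih =>
    rw [List.replicate_succ']
    convert ih.append (HasWrithe.cross u v o (a == decide (Even k)) (!(a == decide (Even k))))
      using 1
    · rcases Nat.even_or_odd k with hk | hk <;> cases o <;> cases a <;>
        simp [hk, crossingSign, positiveCrossing] <;> ring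
    · rcases Nat.even_or_odd k with hk | hk <;> cases a <;> simp [hk, Nat.even_add_one]

/-- Anti-parallel strands stay anti-parallel in the box, so all crossings have the sign of `p`; the
two orientations are exchanged exactly when `p` is odd. -/
theorem hasWrithe_twistBox (u v : List Bool) (p : ℤ) :
    HasWrithe (twistBox u.length p) (u ++ true :: false :: v) p
      (u ++ decide (Even p) :: (!decide (Even p)) :: v) := by
  have h := hasWrithe_replicate_cross u v (decide (p < 0)) true p.natAbs
  have hw : ((p.natAbs : ℕ) : ℤ) * (if decide (p < 0) = true then -1 else 1) = p := by
    simp only [decide_eq_true_eq]; split_ifs <;> omega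
  have he : (true == decide (Even p.natAbs)) = decide (Even p) := by simp [Int.natAbs_even]
  rw [hw, he] at h
  exact h

theorem hasWrithe_boxes (p : ℕ → ℤ) (k : ℕ) (v : List Bool) :
    HasWrithe (boxes p k) (bandOrient (fun _ => true) k ++ v) (∑ i ∈ Finset.range k, p i)
      (bandOrient (fun i => decide (Even (p i))) k ++ v) := by
  induction k generalizing v with
  | zero => exact HasWrithe.nil _
  | succ k ih =>
    have h := hasWrithe_twistBox (bandOrient (fun i => decide (Even (p i))) k) v (p k)
    rw [length_bandOrient] at h
    rw [boxes_succ, bandOrient_succ, bandOrient_succ, Finset.sum_range_succ, List.append_assoc,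
      List.append_assoc]
    exact (ih _).append h

theorem hasWrithe_bandCups (n : ℕ) :
    HasWrithe (bandCups n) [] 0 (bandOrient (fun _ => true) (n + 1)) := by
  induction n with
  | zero => exact HasWrithe.cup 0 true []
  | succ n ih =>
    rw [bandCups_succ]
    convert ih.append (HasWrithe.cup (2 * n + 1) false _) using 1
    · rfl
    · have := orientStep_shift (.cup 1 false) (bandOrient (fun _ => true) n) [true, false]
      rw [length_bandOrient] at this
      rw [bandOrient_succ, bandOrient_succ, List.append_assoc]
      exact this.symm

theorem hasWrithe_hookChain (o : ℕ → Bool) (a : ℕ → Bool) (c : Bool) (j : ℕ) :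
    HasWrithe (hookChain o j) (bandOrient a (j + 1) ++ [c, !c]) 0 [] := by
  induction j with
  | zero => exact (HasWrithe.cap 1 _).append (HasWrithe.cap 0 _)
  | succ j ih =>
    have h := hasWrithe_hookFromRight (bandOrient a j) [c, !c] (o j) (a j) (a (j + 1))
    rw [length_bandOrient] at h
    rw [bandOrient_succ, List.append_assoc] at ih
    rw [hookChain, bandOrient_succ, bandOrient_succ, List.append_assoc, List.append_assoc]
    exact h.append ih

/-- The diagram of `kanenobu`, with parameters indexed by natural numbers. -/
def bandDiagram (o : ℕ → Bool) (p : ℕ → ℤ) (n : ℕ) : List Slice :=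
  bandCups n ++ (boxes p (n + 1) ++
    (hookTip (2 * n) (decide (Even (p 0))) (o n) ++ hookChain o n))

theorem hookChain_eq (o : ℕ → Bool) (n : ℕ) :
    hookChain o n = (List.range n).reverse.flatMap (fun i => hookFromRight (2 * i) (o i)) ++
      [.cap 1, .cap 0] := by
  induction n with
  | zero => rfl
  | succ n ih => rw [hookChain, ih, List.range_succ, List.reverse_append]; simp

theorem kanenobu_eq {n : ℕ} (o : Fin (n + 1) → Bool) (p : Fin (n + 1) → ℤ) :
    kanenobu o p = bandDiagram (fun i => o (Fin.ofNat (n + 1) i)) (fun i => p (Fin.ofNat (n + 1) i))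
      n := by
  have h0 : Fin.ofNat (n + 1) 0 = 0 := rfl
  have hn : Fin.ofNat (n + 1) n = Fin.last n := by ext; simp
  have hb : boxes (fun i => p (Fin.ofNat (n + 1) i)) (n + 1) =
      (List.finRange (n + 1)).flatMap fun i : Fin (n + 1) => twistBox (2 * (i : ℕ)) (p i) := by
    rw [boxes, ← List.map_coe_finRange_eq_range, List.flatMap_map]
    simp
  have hh : (List.range n).reverse.flatMap
        (fun i => hookFromRight (2 * i) (o (Fin.ofNat (n + 1) i))) =
      (List.finRange n).reverse.flatMap
        fun i : Fin n => hookFromRight (2 * (i : ℕ)) (o i.castSucc) := by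
    rw [← List.map_coe_finRange_eq_range, ← List.map_reverse, List.flatMap_map]
    congr 1
    funext i
    congr 2
    ext
    simp
  rw [bandDiagram, hookChain_eq, hb, h0, hn, hh, kanenobu, bandCups]
  simp only [List.append_assoc]

theorem writhe_bandDiagram (o : ℕ → Bool) (p : ℕ → ℤ) (n : ℕ) :
    writhe (bandDiagram o p n) = ∑ i ∈ Finset.range (n + 1), p i := by
  have hb := hasWrithe_boxes p (n + 1) []
  have ht := hasWrithe_hookTip (bandOrient (fun i => decide (Even (p i))) n) []
    (decide (Even (p 0))) (o n) (decide (Even (p n)))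
  have hc := hasWrithe_hookChain o (fun i => decide (Even (p i))) (decide (Even (p 0))) n
  rw [List.append_nil, List.append_nil, bandOrient_succ (fun i => decide (Even (p i)))] at hb
  rw [length_bandOrient] at ht
  rw [bandOrient_succ, List.append_assoc] at hc
  have h := (hasWrithe_bandCups n).append (hb.append (ht.append hc))
  have := h.2 []
  rw [List.append_nil] at this
  rw [writhe, bandDiagram, this]
  simp [writheFrom]

end LinkDiagram

/-! ### The dependence on the boxes -/

namespace LinkDiagram

section Boxes

variable {F : Type*} [Field F] {q : F} {N : ℕ}

theorem diagramOp_twistBox (x : ℕ) (p : ℤ) :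
    diagramOp q N (twistBox x p) = sliceOp q N (.cross x (decide (p < 0))) ^ p.natAbs := by
  simp [diagramOp, twistBox]

theorem length_orientAbove_replicate_cross (x : ℕ) (o : Bool) (k : ℕ) (ω : List Bool) :
    (orientAbove (List.replicate k (.cross x o)) ω).length = ω.length := by
  induction k generalizing ω with
  | zero => rfl
  | succ k ih =>
    rw [List.replicate_succ]
    change (orientAbove _ (orientStep (.cross x o) ω)).length = _
    rw [ih]
    simp only [orientStep]
    split
    · rename_i a b r h
      have := congrArg List.length h
      simp at this ⊢
      omega
    · rfl

theorem length_orientAbove_boxes (p : ℕ → ℤ) (k : ℕ) (ω : List Bool) :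
    (orientAbove (boxes p k) ω).length = ω.length := by
  induction k with
  | zero => rfl
  | succ k ih =>
    rw [boxes_succ, orientAbove_append, twistBox, length_orientAbove_replicate_cross, ih]

theorem diagramOp_boxes_congr (p : ℕ → ℤ) (k : ℕ) {f g : List (Bool × Fin N) → F}
    (σ : List (Bool × Fin N)) (h : ∀ τ : List (Bool × Fin N), τ.length = σ.length → f τ = g τ) :
    diagramOp q N (boxes p k) f σ = diagramOp q N (boxes p k) g σ :=
  diagramOp_congr _ σ fun τ hτ => h τ <| by
    have := congrArg List.length hτ
    rwa [length_orientAbove_boxes, List.length_map, List.length_map] at this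

theorem cross_pow_congr (x : ℕ) (o : Bool) (k : ℕ) {f g : List (Bool × Fin N) → F}
    (σ : List (Bool × Fin N)) (h : ∀ τ : List (Bool × Fin N), τ.length = σ.length → f τ = g τ) :
    (sliceOp q N (.cross x o) ^ k) f σ = (sliceOp q N (.cross x o) ^ k) g σ := by
  have e : sliceOp q N (.cross x o) ^ k = diagramOp q N (List.replicate k (.cross x o)) := by
    simp [diagramOp]
  rw [e]
  exact diagramOp_congr _ σ fun τ hτ => h τ <| by
    have := congrArg List.length hτ
    rwa [length_orientAbove_replicate_cross, List.length_map, List.length_map] at this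

variable (hq : q ≠ 0)
include hq

/-- For `p ≥ 0` a crossing is appended to the box. For `p < 0` the new positive crossing cancels a
negative one. -/
theorem twistBox_add_one (x : ℕ) (p : ℤ) (f : List (Bool × Fin N) → F) (σ : List (Bool × Fin N))
    (h : x + 2 ≤ σ.length) :
    diagramOp q N (twistBox x (p + 1)) f σ =
      diagramOp q N (twistBox x p) (sliceOp q N (.cross x false) f) σ := by
  rw [diagramOp_twistBox, diagramOp_twistBox]
  rcases lt_or_ge p 0 with hp | hp
  · obtain ⟨k, rfl⟩ : ∃ k : ℕ, p = -(k : ℤ) - 1 := ⟨(-p - 1).toNat, by omega⟩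
    have e1 : (-(k : ℤ) - 1).natAbs = k + 1 := by omega
    have e2 : (-(k : ℤ) - 1 + 1).natAbs = k := by omega
    rw [e1, e2, decide_eq_true hp, pow_succ, Module.End.mul_apply]
    refine Eq.trans ?_ (cross_pow_congr x true k (f := f) σ
      fun τ hτ => (cross_mul_cross_apply N hq x true f τ (by omega)).symm)
    -- At p = -1 the new box is empty, so its default crossing type, which changes there, does not
    -- matter.
    cases k with
    | zero => rfl
    | succ k => rw [decide_eq_true (by push_cast; omega)]
  · have e1 : (p + 1).natAbs = p.natAbs + 1 := by omega
    rw [e1, decide_eq_false (by omega), decide_eq_false (by omega), pow_succ, Module.End.mul_apply]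

theorem twistBox_add_two (x : ℕ) (p : ℤ) (f : List (Bool × Fin N) → F) (σ : List (Bool × Fin N))
    (h : x + 2 ≤ σ.length) :
    diagramOp q N (twistBox x (p + 2)) f σ = diagramOp q N (twistBox x p)
      (sliceOp q N (.cross x false) (sliceOp q N (.cross x false) f)) σ := by
  rw [show p + 2 = p + 1 + 1 by ring, twistBox_add_one hq x _ _ σ h, twistBox_add_one hq x _ _ σ h]

/-- A lock added to the box `i` may be moved above all boxes. -/
theorem boxes_add_two {p p' : ℕ → ℤ} {i k : ℕ} (hi : i < k) (hp : p' i = p i + 2)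
    (hp' : ∀ j < k, j ≠ i → p' j = p j) (f : List (Bool × Fin N) → F) (σ : List (Bool × Fin N))
    (h : 2 * k ≤ σ.length) :
    diagramOp q N (boxes p' k) f σ = diagramOp q N (boxes p k)
      (sliceOp q N (.cross (2 * i) false) (sliceOp q N (.cross (2 * i) false) f)) σ := by
  induction k generalizing f with
  | zero => omega
  | succ k ih =>
    rw [boxes_succ, boxes_succ, diagramOp_append, diagramOp_append, Module.End.mul_apply,
      Module.End.mul_apply]
    rcases Nat.lt_succ_iff_lt_or_eq.mp hi with hik | rfl
    · rw [ih hik (fun j hj => hp' j (by omega)) _ (by omega), hp' k (by omega) (by omega)]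
      -- Box `k` lies to the right of band `i`, so the lock passes it.
      have hc : Commute (sliceOp q N (.cross (2 * i) false))
          (diagramOp q N (twistBox (2 * k) (p k))) := by
        rw [diagramOp_twistBox]
        apply Commute.pow_right
        have := cross_mul_shift q N (2 * i) false (.cross (2 * k - 2) (decide (p k < 0)))
          (by simp only [Slice.pos]; omega)
        rw [Slice.shift, show 2 + (2 * k - 2) = 2 * k by omega] at this
        exact this
      simp only [← Module.End.mul_apply]
      rw [← (hc.mul_left hc).eq, mul_assoc]
    · have hb : boxes p' i = boxes p i := by
        simp only [boxes]
        refine List.flatMap_congr fun j hj => ?_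
        rw [hp' j (by simp at hj; omega) (by simp at hj; omega)]
      rw [hb, hp]
      exact diagramOp_boxes_congr p i σ fun τ hτ => twistBox_add_two hq _ _ f τ (by omega)

/-- The expansion of a lock of two anti-parallel strands. -/
theorem lock_apply (f : List (Bool × Fin N) → F) (a : Bool) (i j : Fin N)
    (u v : List (Bool × Fin N)) :
    sliceOp q N (.cross u.length false) (sliceOp q N (.cross u.length false) f)
        (u ++ (a, i) :: (!a, j) :: v) =
      f (u ++ (a, i) :: (!a, j) :: v) + (q - q⁻¹) * q ^ N *
        sliceOp q N (.cap u.length) (sliceOp q N (.cup u.length a) f)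
          (u ++ (a, i) :: (!a, j) :: v) := by
  set σ := u ++ (a, i) :: (!a, j) :: v with hσ
  -- The skein relation is applied to the upper crossing. In one term it cancels the lower crossing;
  -- in the other the lower crossing becomes a kink below a cap and contributes q ^ N.
  have h1 : sliceOp q N (.cross u.length false) (sliceOp q N (.cross u.length false) f) σ =
      sliceOp q N (.cross u.length false) (sliceOp q N (.cross u.length true) f +
        (q - q⁻¹) • sliceOp q N (.cap u.length) (sliceOp q N (.cup u.length a) f)) σ := by
    refine sliceOp_congr _ σ fun τ hτ => ?_
    have hτ' : τ.map Prod.fst = u.map Prod.fst ++ (!a) :: a :: v.map Prod.fst := by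
      rw [hτ, hσ, List.map_append]
      have := orientStep_shift (.cross 0 false) (u.map Prod.fst) (a :: (!a) :: v.map Prod.fst)
      rw [List.length_map] at this
      exact this
    obtain ⟨u', w, rfl, hu', hw1⟩ := List.map_eq_append_iff.mp hτ'
    obtain ⟨⟨_, i'⟩, w, rfl, rfl, hw2⟩ := List.map_eq_cons_iff.mp hw1
    obtain ⟨⟨t, j'⟩, w, rfl, ht, -⟩ := List.map_eq_cons_iff.mp hw2
    have hl : u.length = u'.length := by simpa using (congrArg List.length hu').symm
    have := sliceOp_skein N hq f (!a) i' j' u' w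
    rw [Bool.not_not, ← hl] at this
    rw [show t = a from ht]
    exact this
  have h3 : sliceOp q N (.cross u.length false) (sliceOp q N (.cross u.length true) f) σ = f σ :=
    cross_mul_cross_apply N hq _ false f σ (by simp [hσ])
  rw [h1, map_add, map_smul, Pi.add_apply, Pi.smul_apply, smul_eq_mul, h3]
  have h2 := cross_mul_cap_self N hq u.length false
  simp only [Bool.false_eq_true, if_false] at h2
  rw [← Module.End.mul_apply (sliceOp q N (.cross _ _)), h2, LinearMap.smul_apply, Pi.smul_apply,
    smul_eq_mul, mul_assoc]

/-- Since band `k` is among the capped ones, its half-twists are kinks, each undone at the cost of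
one framing factor. -/
theorem twistBox_mul_cap_pow (p : ℤ) (k m : ℕ) (h : k < m) :
    diagramOp q N (twistBox (2 * k) p) * sliceOp q N (.cap 0) ^ m =
      ((q ^ N) ^ p) • sliceOp q N (.cap 0) ^ m := by
  obtain ⟨m, rfl⟩ : ∃ m', m = m' + 1 := ⟨m - 1, by omega⟩
  have hc := cap_mul_cap_pow q N 0 k m (by omega)
  rw [zero_add] at hc
  rw [← hc, ← mul_assoc, ← smul_mul_assoc]
  congr 1
  rw [diagramOp_twistBox]
  have h1 : ∀ (o : Bool) (j : ℕ), sliceOp q N (.cross (2 * k) o) ^ j * sliceOp q N (.cap (2 * k)) =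
      ((if o then (q ^ N)⁻¹ else q ^ N) ^ j) • sliceOp q N (.cap (2 * k)) := fun o j => by
    induction j with
    | zero => simp
    | succ j ih =>
      rw [pow_succ, mul_assoc, cross_mul_cap_self N hq, mul_smul_comm, ih, smul_smul, pow_succ,
        mul_comm]
  rw [h1]
  congr 1
  rcases lt_or_ge p 0 with hp | hp
  · rw [decide_eq_true hp, if_pos rfl, inv_pow, ← zpow_natCast, ← zpow_neg]
    congr 1; omega
  · rw [decide_eq_false (by omega), if_neg (by simp), ← zpow_natCast]
    congr 1; omega

theorem boxes_mul_cap_pow (p : ℕ → ℤ) (k m : ℕ) (h : k ≤ m) :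
    diagramOp q N (boxes p k) * sliceOp q N (.cap 0) ^ m =
      ((q ^ N) ^ (∑ i ∈ Finset.range k, p i)) • sliceOp q N (.cap 0) ^ m := by
  induction k with
  | zero => simp [boxes]
  | succ k ih =>
    rw [boxes_succ, diagramOp_append, mul_assoc, twistBox_mul_cap_pow hq _ _ _ h, mul_smul_comm,
      ih (by omega), smul_smul, Finset.sum_range_succ, zpow_add₀ (pow_ne_zero N hq), mul_comm]

/-- With all bands closed, the last cup and cap straighten to one vertical strand. This removes the
bands one at a time until a single circle is left. -/
theorem bandCups_cap_pow (hq' : q - q⁻¹ ≠ 0) (n : ℕ) (f : List (Bool × Fin N) → F) :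
    diagramOp q N (bandCups n) ((sliceOp q N (.cap 0) ^ (n + 1)) f) [] = dimAt q N * f [] := by
  induction n with
  | zero =>
    simpa [bandCups, diagramOp] using cup_mul_cap_self N hq hq' 0 true f [] le_rfl
  | succ n ih =>
    rw [← ih, bandCups_succ, diagramOp_append, Module.End.mul_apply]
    refine diagramOp_congr _ [] fun τ hτ => ?_
    rw [List.map_nil, (hasWrithe_bandCups n).1, bandOrient_succ] at hτ
    obtain ⟨u, w, rfl, hu, hw⟩ := List.map_eq_append_iff.mp hτ
    obtain ⟨s, w, rfl, hs, hw⟩ := List.map_eq_cons_iff.mp hw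
    have hl : u.length = 2 * n := by
      have := congrArg List.length hu
      rwa [List.length_map, length_bandOrient] at this
    have hc := cap_mul_cap_pow q N 0 n (n + 1) (by omega)
    rw [zero_add, ← hl] at hc
    have := cup_mul_cap_right N hq u w s ((sliceOp q N (.cap 0) ^ (n + 1)) f)
    rw [hs] at this
    simp only [diagramOp_cons, diagramOp_nil, mul_one]
    rw [← hc, Module.End.mul_apply, ← hl]
    exact this

/-- The effect of a lock on the state sum. -/
theorem stateSumFrom_bandDiagram_add_two (hq' : q - q⁻¹ ≠ 0) (o : ℕ → Bool) {p p' : ℕ → ℤ}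
    {i n : ℕ} (hi : i < n + 1) (hp : p' i = p i + 2) (hp' : ∀ j < n + 1, j ≠ i → p' j = p j) :
    stateSumFrom q N (bandDiagram o p' n) [] = stateSumFrom q N (bandDiagram o p n) [] +
      (q - q⁻¹) * q ^ N * dimAt q N *
        ((q ^ N) ^ (∑ i ∈ Finset.range (n + 1), p i) * dimAt q N) := by
  -- The finger of band 0 is oriented by the parity of its box, which a lock does not change, so the
  -- part above the boxes is the same for both diagrams.
  have h0 : decide (Even (p' 0)) = decide (Even (p 0)) := by
    by_cases h : i = 0
    · subst h; simp [hp]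
    · rw [hp' 0 (by omega) (Ne.symm h)]
  obtain ⟨k, rfl⟩ : ∃ k, n = i + k := ⟨n - i, by omega⟩
  rw [stateSumFrom_eq, stateSumFrom_eq, bandDiagram, bandDiagram, h0]
  set δ : List (Bool × Fin N) → F := fun τ => if τ = [] then 1 else 0
  set top := hookTip (2 * (i + k)) (decide (Even (p 0))) (o (i + k)) ++ hookChain o (i + k)
  simp only [diagramOp_append _ (bandCups _), diagramOp_append _ (boxes _ _), Module.End.mul_apply]
  set C := (sliceOp q N (.cap 0) ^ (i + k + 1)) δ with hC
  have key : diagramOp q N (bandCups (i + k)) (diagramOp q N (boxes p' (i + k + 1))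
        (diagramOp q N top δ)) [] =
      diagramOp q N (bandCups (i + k)) (diagramOp q N (boxes p (i + k + 1))
        (diagramOp q N top δ + ((q - q⁻¹) * q ^ N * dimAt q N) • C)) [] := by
    refine diagramOp_congr _ [] fun τ hτ => ?_
    rw [List.map_nil, (hasWrithe_bandCups _).1] at hτ
    have hl : τ.length = 2 * (i + k + 1) := by
      have := congrArg List.length hτ
      rwa [List.length_map, length_bandOrient] at this
    rw [boxes_add_two hq hi hp hp' _ _ hl.ge]
    refine diagramOp_congr _ τ fun ρ hρ => ?_
    have hb := (hasWrithe_boxes p (i + k + 1) []).1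
    rw [List.append_nil, List.append_nil] at hb
    rw [hτ, hb] at hρ
    set a : ℕ → Bool := fun i => decide (Even (p i))
    obtain ⟨v, hv, hvl⟩ := bandOrient_add a (i + 1) k
    obtain ⟨ω, hω⟩ := bandOrient_succ_eq_cons a i
    rw [show i + k + 1 = i + 1 + k by ring, hv, bandOrient_succ, List.append_assoc] at hρ
    rw [bandOrient_succ] at hω
    obtain ⟨u, w, rfl, hu, hw⟩ := List.map_eq_append_iff.mp hρ
    obtain ⟨⟨s, x⟩, w, rfl, hs, hw⟩ := List.map_eq_cons_iff.mp hw
    obtain ⟨⟨t, y⟩, w, rfl, ht, hw⟩ := List.map_eq_cons_iff.mp hw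
    have hul : u.length = 2 * i := by
      have := congrArg List.length hu
      rwa [List.length_map, length_bandOrient] at this
    have hwl : w.length = 2 * k := by
      have := congrArg List.length hw
      simpa [hvl] using this
    simp only at hs ht
    subst hs ht
    have lock := lock_apply hq (diagramOp q N top δ) (a i) x y u w
    rw [hul] at lock
    rw [lock, cap_cup_hookTip_hookChain hq hq' o (a i) (decide (Even (p 0))) (o (i + k)) i k δ u _
      hul (by simp [hwl]; ring) ω (by rw [hu, hω])]
    simp only [Pi.add_apply, Pi.smul_apply, smul_eq_mul, hC]
    ring
  have hbox := boxes_mul_cap_pow (N := N) hq p (i + k + 1) (i + k + 1) le_rfl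
  rw [key, map_add, map_add, Pi.add_apply, map_smul, map_smul, Pi.smul_apply, hC,
    ← Module.End.mul_apply _ (_ ^ _), hbox, LinearMap.smul_apply, map_smul,
    Pi.smul_apply, bandCups_cap_pow hq hq']
  simp [δ]

end Boxes

end LinkDiagram

/-! ### The invariant up to locks -/

namespace LinkDiagram

section Invariant

variable {F : Type*} [Field F] {q : F}

theorem sum_range_ofNat {M : Type*} [AddCommMonoid M] {n : ℕ} (p : Fin (n + 1) → M) :
    ∑ i ∈ Finset.range (n + 1), p (Fin.ofNat (n + 1) i) = ∑ i, p i := by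
  rw [← Fin.sum_univ_eq_sum_range (fun i => p (Fin.ofNat (n + 1) i))]
  simp

/-- The part of the state sum of `kanenobu o p` that is unchanged by locks in the boxes. -/
def reducedStateSum (q : F) (N : ℕ) {n : ℕ} (o : Fin (n + 1) → Bool) (p : Fin (n + 1) → ℤ) : F :=
  stateSumFrom q N (kanenobu o p) [] - (q ^ N) ^ (∑ i, p i) * dimAt q N

/-- The writhe correction cancels the power of A in the subtracted term, which leaves D. -/
theorem homflyAt_kanenobu (hq : q ≠ 0) (N : ℕ) {n : ℕ} (o : Fin (n + 1) → Bool)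
    (p : Fin (n + 1) → ℤ) :
    homflyAt q N (kanenobu o p) =
      (q ^ N) ^ (-∑ i, p i) * reducedStateSum q N o p + dimAt q N := by
  have hw : writhe (kanenobu o p) = ∑ i, p i := by
    rw [kanenobu_eq, writhe_bandDiagram, sum_range_ofNat]
  have h : (q ^ N) ^ (∑ i, p i) ≠ 0 := zpow_ne_zero _ (pow_ne_zero N hq)
  rw [homflyAt, hw, reducedStateSum, zpow_neg]
  field_simp
  ring

variable (hq : q ≠ 0) (hq' : q - q⁻¹ ≠ 0)
include hq hq'

theorem reducedStateSum_update_add_two (N : ℕ) {n : ℕ} (o : Fin (n + 1) → Bool)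
    (p : Fin (n + 1) → ℤ) (i : Fin (n + 1)) :
    reducedStateSum q N o (Function.update p i (p i + 2)) = reducedStateSum q N o p := by
  have hA : q ^ N ≠ 0 := pow_ne_zero N hq
  have h := stateSumFrom_bandDiagram_add_two (N := N) hq hq' (fun i => o (Fin.ofNat (n + 1) i))
    (p := fun i => p (Fin.ofNat (n + 1) i))
    (p' := fun j => Function.update p i (p i + 2) (Fin.ofNat (n + 1) j)) (i := i) (n := n) i.isLt
    (by simp) (fun j hj hji => by
      rw [Function.update_of_ne]
      rintro rfl
      exact hji (by simp [Nat.mod_eq_of_lt hj]))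
  rw [← kanenobu_eq, ← kanenobu_eq, sum_range_ofNat] at h
  have hs : ∑ j, Function.update p i (p i + 2) j = ∑ j, p j + 2 := by
    rw [Finset.sum_update_of_mem (Finset.mem_univ i),
      Finset.sum_eq_add_sum_sdiff_singleton_of_mem (Finset.mem_univ i) p]
    ring
  have hD : (q - q⁻¹) * dimAt q N = q ^ N - (q ^ N)⁻¹ := by
    rw [dimAt, mul_div_cancel₀ _ hq']
  rw [reducedStateSum, reducedStateSum, h, hs, zpow_add₀ hA]
  -- A(q - q⁻¹)D = A² - 1: the contribution of a lock equals the change of the subtracted term when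
  -- the sum of the parameters grows by 2.
  have e : (q - q⁻¹) * q ^ N * dimAt q N = (q ^ N) ^ (2 : ℤ) - 1 := by
    rw [mul_right_comm, hD, sub_mul, inv_mul_cancel₀ hA, zpow_ofNat, sq]
  rw [e]
  ring

theorem reducedStateSum_update_add_two_mul (N : ℕ) {n : ℕ} (o : Fin (n + 1) → Bool)
    (p : Fin (n + 1) → ℤ) (i : Fin (n + 1)) (k : ℤ) :
    reducedStateSum q N o (Function.update p i (p i + 2 * k)) = reducedStateSum q N o p := by
  have step : ∀ k : ℤ, reducedStateSum q N o (Function.update p i (p i + 2 * (k + 1))) =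
      reducedStateSum q N o (Function.update p i (p i + 2 * k)) := fun k => by
    rw [← reducedStateSum_update_add_two hq hq' N o (Function.update p i (p i + 2 * k)) i]
    congr 1
    simp only [Function.update_self, Function.update_idem]
    congr 1; ring
  induction k using Int.induction_on with
  | zero => simp
  | succ k ih => rw [step, ih]
  | pred k ih => rw [← ih, ← step]; congr 3; ring

/-- The parameters are exchanged one band at a time, each by an even amount. -/
theorem reducedStateSum_congr (N : ℕ) {n : ℕ} (o : Fin (n + 1) → Bool) (p p' : Fin (n + 1) → ℤ)
    (h : ∀ i, p i ≡ p' i [ZMOD 2]) : reducedStateSum q N o p = reducedStateSum q N o p' := by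
  have key : ∀ S : Finset (Fin (n + 1)),
      reducedStateSum q N o (fun i => if i ∈ S then p i else p' i) = reducedStateSum q N o p' := by
    intro S
    induction S using Finset.induction_on with
    | empty => simp
    | insert a S ha ih =>
      obtain ⟨k, hk⟩ := (h a).symm.dvd
      rw [← ih, ← reducedStateSum_update_add_two_mul hq hq' N o
        (fun i => if i ∈ S then p i else p' i) a k]
      congr 1
      funext i
      by_cases hi : i = a
      · subst hi; simp [ha]; omega
      · simp [hi]
  simpa using key Finset.univ

theorem chainCoeffAt_mul_dimAt (N : ℕ) (m : ℤ) :
    chainCoeffAt q N m * dimAt q N = (q ^ N) ^ (2 * m) - 1 := by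
  have hA : q ^ N ≠ 0 := pow_ne_zero N hq
  have hD : (q - q⁻¹) * dimAt q N = q ^ N - (q ^ N)⁻¹ := by
    rw [dimAt, mul_div_cancel₀ _ hq']
  obtain ⟨k, rfl | rfl⟩ := m.eq_nat_or_neg
  · have e : 1 + q ^ N * (q - q⁻¹) * dimAt q N = (q ^ N) ^ 2 := by
      rw [mul_assoc, hD, mul_sub, mul_inv_cancel₀ hA]; ring
    rw [chainCoeffAt, chainCoeff_natCast_mul, e, ← pow_mul]
    norm_cast
  · have e : 1 + -((q ^ N)⁻¹ * (q - q⁻¹)) * dimAt q N = ((q ^ N) ^ 2)⁻¹ := by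
      rw [neg_mul, mul_assoc, hD, mul_sub, inv_mul_cancel₀ hA, sq, mul_inv]; ring
    rw [chainCoeffAt, chainCoeff_neg_mul, e, mul_neg, zpow_neg, inv_pow, ← pow_mul]
    norm_cast

end Invariant

/-! ### Specialisation of the two-variable polynomials -/

theorem qVar_ne_zero : qVar ≠ 0 := RatFunc.X_ne_zero

theorem qVar_sub_inv_ne_zero : qVar - qVar⁻¹ ≠ 0 := by
  intro h
  have h2 : qVar * qVar = 1 := by
    rw [sub_eq_zero] at h
    nth_rewrite 2 [h]
    exact mul_inv_cancel₀ qVar_ne_zero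
  -- Otherwise X² = 1 would already hold for polynomials, which evaluation at 2 refutes.
  have h3 : (Polynomial.X * Polynomial.X : Polynomial ℚ) = 1 := by
    apply RatFunc.algebraMap_injective ℚ
    rw [map_mul, RatFunc.algebraMap_X, map_one]
    exact h2
  have h4 := congrArg (Polynomial.eval 2) h3
  norm_num at h4

theorem specialise_C (N : ℕ) (r : RatFunc ℚ) : specialise N (LaurentPolynomial.C r) = r := by
  simp [specialise]

theorem specialise_powA (N : ℕ) (k : ℤ) : specialise N (powA k) = (qVar ^ N) ^ k := by
  simp [specialise, powA]

theorem specialise_dimTwo (N : ℕ) : specialise N dimTwo = dimAt qVar N := by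
  rw [dimTwo, map_mul, map_sub, specialise_powA, specialise_powA, specialise_C, dimAt,
    div_eq_mul_inv, zpow_one, zpow_neg_one]

theorem map_chainCoeff {R S : Type*} [CommRing R] [CommRing S] (f : R →+* S) (φ φ' D : R) (m : ℤ) :
    f (chainCoeff φ φ' D m) = chainCoeff (f φ) (f φ') (f D) m := by
  cases m <;> simp [chainCoeff]

theorem specialise_chainCoeffTwo (N : ℕ) (m : ℤ) :
    specialise N (chainCoeffTwo m) = chainCoeffAt qVar N m := by
  rw [chainCoeffTwo, map_chainCoeff, map_neg, map_mul, map_mul, specialise_powA, specialise_powA,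
    specialise_dimTwo, braceQ, specialise_C, chainCoeffAt, zpow_one, zpow_neg_one]

end LinkDiagram

open LinkDiagram in
theorem mainTheorem8 (n : ℕ) (o : Fin (n + 1) → Bool) :
    (∀ m ε : Fin (n + 1) → ℤ, (∀ i, ε i = 0 ∨ ε i = 1) →
      (∀ N : ℕ, 1 ≤ N →
        (qVar ^ N) ^ (2 * ∑ i, m i) * homflyAt qVar N (kanenobu o fun i => 2 * m i + ε i)
          = homflyAt qVar N (kanenobu o ε) + chainCoeffAt qVar N (∑ i, m i) * dimAt qVar N ^ 2) ∧
      (∀ P : LaurentPolynomial (RatFunc ℚ), IsHomfly (kanenobu o ε) P →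
        IsHomfly (kanenobu o fun i => 2 * m i + ε i)
          (powA (-(2 * ∑ i, m i)) * (P + chainCoeffTwo (∑ i, m i) * dimTwo ^ 2)))) ∧
    (∀ p p' : Fin (n + 1) → ℤ, (∀ i, p i ≡ p' i [ZMOD 2]) → ∑ i, p i = ∑ i, p' i →
      (∀ N : ℕ, 1 ≤ N → homflyAt qVar N (kanenobu o p) = homflyAt qVar N (kanenobu o p')) ∧
      (∀ P : LaurentPolynomial (RatFunc ℚ),
        IsHomfly (kanenobu o p) P ↔ IsHomfly (kanenobu o p') P)) := by
  have main : ∀ (m ε : Fin (n + 1) → ℤ) (N : ℕ),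
      (qVar ^ N) ^ (2 * ∑ i, m i) * homflyAt qVar N (kanenobu o fun i => 2 * m i + ε i)
        = homflyAt qVar N (kanenobu o ε) +
          chainCoeffAt qVar N (∑ i, m i) * dimAt qVar N ^ 2 := by
    intro m ε N
    have hA : qVar ^ N ≠ 0 := pow_ne_zero N qVar_ne_zero
    rw [homflyAt_kanenobu qVar_ne_zero, homflyAt_kanenobu qVar_ne_zero,
      reducedStateSum_congr qVar_ne_zero qVar_sub_inv_ne_zero N o (fun i => 2 * m i + ε i) ε
        fun i => by simp [Int.ModEq], sq, ← mul_assoc,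
      chainCoeffAt_mul_dimAt qVar_ne_zero qVar_sub_inv_ne_zero, mul_add, ← mul_assoc,
      ← zpow_add₀ hA, Finset.sum_add_distrib, ← Finset.mul_sum]
    -- The framing factor of the locks cancels their share of the writhe, so the reduced state sum
    -- has the same coefficient on both sides; only the multiples of D differ.
    rw [show 2 * ∑ i, m i + -(2 * ∑ i, m i + ∑ i, ε i) = -∑ i, ε i by ring]
    ring
  have same : ∀ p p' : Fin (n + 1) → ℤ, (∀ i, p i ≡ p' i [ZMOD 2]) → ∑ i, p i = ∑ i, p' i →
      ∀ N : ℕ, homflyAt qVar N (kanenobu o p) = homflyAt qVar N (kanenobu o p') := by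
    intro p p' h hs N
    rw [homflyAt_kanenobu qVar_ne_zero, homflyAt_kanenobu qVar_ne_zero, hs,
      reducedStateSum_congr qVar_ne_zero qVar_sub_inv_ne_zero N o p p' h]
  refine ⟨fun m ε _ => ⟨fun N _ => main m ε N, fun P hP N hN => ?_⟩,
    fun p p' h hs => ⟨fun N _ => same p p' h hs N, fun P => ?_⟩⟩
  · have hA : qVar ^ N ≠ 0 := pow_ne_zero N qVar_ne_zero
    rw [map_mul, map_add, map_mul, map_pow, specialise_powA, specialise_chainCoeffTwo,
      specialise_dimTwo, hP N hN, ← main m ε N, ← mul_assoc, ← zpow_add₀ hA, neg_add_cancel,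
      zpow_zero, one_mul]
  · refine forall₂_congr fun N _ => ?_
    rw [same p p' h hs N]
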